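/- **Model.** For $\Lambda=[-K,K']\cap\mathbb Z$ with $K,K'\ge 0$, let $$H=\sum_{i=-K}^{K'}h_iS^z_i+\sum_{i=-K}^{K'}\gamma\Gamma_iS^x_i+\sum_{i=-K-1}^{K'}J_iS^z_iS^z_{i+1}$$ act on $\bigotimes_{i\in\Lambda}\mathbb C^2$ ($S^x_i,S^z_i$ Pauli matrices, $S^z_i=1$ for $i\notin\Lambda$). The random variables $h_i,\Gamma_i,J_i$ ($i\in\mathbb Z$) are independent, bounded by $1$, with probability densities bounded by $\rho_0$. Put $\varepsilon=\gamma^{1/20}$, $L_k=(15/8)^k$, $d_m=\exp(L_{m+m_0}^{1/2})$, with a fixed integer $m_0>0$. Basis vectors are labeled by $\sigma\in\{-1,1\}^\Lambda$ ($\sigma_i=1$ off $\Lambda$), $\sigma^{(i)}$ is $\sigma$ flipped at $i$, $E(\sigma)$ is the diagonal entry of $H$, and $H_0$ is the diagonal part of $H$. LLA$(\nu,C)$ (with $\nu>0$) says that in every box of $n$ sites $P(\min_{\alpha\ne\beta}|E_\alpha-E_\beta|<\delta)\le\delta^\nu C^n$ for all $\delta>0$, where the $E_\alpha$ are the eigenvalues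 of $H$ counted with multiplicity. **Step 1.** A site $i\in\Lambda$ is resonant if $|E(\sigma)-E(\sigma^{(i)})|<\varepsilon$ for some $\sigma$; $\mathcal S_1$ is the set of resonant sites. The small blocks $b^{(1)}$ are the nearest-neighbor components of $\mathcal S_1$ of diameter $<L_1$ at distance $>d_1$ from the rest of $\mathcal S_1$; $\mathcal S_{1'}$ is $\mathcal S_1$ without the small blocks. A bar denotes addition of a collar of one site (in $\Lambda$), and $\bar{\bar b}^{(1)}$ is $\bar b^{(1)}$ with one more such collar. Let $J(i)=\gamma\Gamma_iS^x_i$; for $i\notin\mathcal S_1$ let $A(i)_{\sigma\sigma^{(i)}}=\gamma\Gamma_i/(E(\sigma)-E(\sigma^{(i)}))$, all other entries being $0$; $A=\sum_{i\in\Lambda\setminus\mathcal S_1}A(i)$ and $\Omega^{(1)}=e^{-A}$. Expand $$e^AHe^{-A}-H_0=\sum_{i_0\in\mathcal S_1}\sum_{n\ge0}\tfrac1{n!}(\mathrm{ad}\,A)^nJ(i_0)+\sum_{i_0\notin\mathcal S_1}\sum_{n\ge1}\tfrac n{(n+1)!}(\mathrm{ad}\,A)^nJ(i_0)$$ into ordered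 products of one factor $J(i_0)$ and $n$ factors $A(i_p)$, coming from nested commutators $(\mathrm{ad}\,A(i_n))\cdots(\mathrm{ad}\,A(i_1))J(i_0)$ for sequences in which each $i_p$ is within distance $1$ of $\{i_0,\dots,i_{p-1}\}$, like terms being gathered. Each ordered product is a graph $g$ of length $|g|=n+1$; $J^{(1)}(g)$ is its term with its coefficient. $J^{(1)\mathrm{sint}}$ is the sum of the terms of graphs that meet $\mathcal S_1$ and whose sites lie in some $\bar b^{(1)}$. A graph is external if it does not meet $\mathcal S_1$ or is not contained in $\bar{\mathcal S}_1$. $O^{(1)}=\prod_bO_b$ is a product over the small blocks $b^{(1)}$ of orthogonal matrices $O_b$, each changing only the spins in $\bar b^{(1)}$ and depending only on those in $\bar{\bar b}^{(1)}$, that diagonalize $H_0$ plus the part of $J^{(1)\mathrm{sint}}$ in $\bar b^{(1)}$. $E^{(1')}_\sigma$ are the diagonal entries of $O^{(1)\mathrm{tr}}(H_0+J^{(1)\mathrm{sint}})O^{(1)}$. **Step 2.** A graph $g$ touches $b^{(1)}$ if it has a flip in $\bar{\bar b}^{(1)}$; the support of $g$ is the union of its sites and of the $\bar b^{(1)}$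 for the blocks it touches; $O_g$ is the product of $O_b$ over the touched blocks, and $J^{(1')}(g)=O_g^{\mathrm{tr}}J^{(1)}(g)O_g$. $I(g)$ is the smallest interval containing the sites of $g$ and the $\bar{\bar b}^{(1)}$ it touches; $|I(g)|$ is the number of blocks $\bar{\bar b}^{(1)}$ in it plus the number of its other sites. Consider external $g$ with $2\le|g|\le3$ and support disjoint from $\mathcal S_{1'}$, and configurations $\alpha\ne\beta$, $\sigma$, where $\tilde\sigma$ is obtained from $\sigma$ by the flips of $g$ and $\alpha=\sigma$, $\beta=\tilde\sigma$ outside the touched $\bar b^{(1)}$. Such a $(g,\alpha,\sigma,\beta)$ is resonant if $|E^{(1')}_\alpha-E^{(1')}_\beta|<\varepsilon^{|g|}$, or if $|I(g)|\ge\frac78|g|$ and $$\left|\frac{(O_g)_{\sigma\alpha}J^{(1)}(g)_{\sigma\tilde\sigma}(O_g)_{\tilde\sigma\beta}}{E^{(1')}_\alpha-E^{(1')}_\beta}\right|>\frac{(\gamma/\varepsilon)^{|g|}}{((|g|-1)!)^{2/9}}.$$ Let $B^{(2)}$ be the union of the supports of the $g$ that are resonant for some $\alpha,\sigma,\beta$.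 Starting from $\mathcal S_1\cup B^{(2)}$, successively for $m=1,2,3$ remove, among the components for connections of length $\le d_m$ of what remains, those of diameter $<L_2$ and size $<L_m$. Here the size of a $b^{(1)}$ disjoint from $B^{(2)}$ is its number of sites; otherwise the size is the number of sites outside all $\bar b^{(1)}$ plus the number of $\bar b^{(1)}$ met, but at least $2$. The removed sets that are not step 1 small blocks disjoint from $B^{(2)}$ are the small blocks $b^{(2)}$; $\mathcal S_2$ is the union of the $b^{(2)}$ and of what finally remains. Let $|x-y|^{(1)}$ be the distance with each $\bar{\bar b}^{(1)}$ contracted to a point; $\bar b^{(2)}$ is $b^{(2)}$ with a collar of three steps, and $\bar{\bar b}^{(2)}$ is $\bar b^{(2)}$ with a further collar of two steps, in this distance. Let $$A^{(2)}(g)_{\alpha\beta}=\frac{J^{(1')}(g)_{\alpha\beta}}{E^{(1')}_\alpha-E^{(1')}_\beta}\quad(\alpha\ne\beta),\qquad A^{(2)}(g)_{\alpha\alpha}=0 ,$$ let $A^{(2)}$ be the sum of $A^{(2)}(g)$ over external $g$ with $2\le|g|\le3$ and support disjoint from $\mathcal S_2$, and $\Omega^{(2)}=e^{-A^{(2)}}$.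 The part of $J^{(2)\mathrm{sint}}$ in a block $b^{(2)}$ is $\sum_{n\ge0}\frac1{n!}(\mathrm{ad}\,A')^nJ'$, where $A'$ is the sum of those $A^{(2)}(g)$ whose support is contained in $\bar b^{(2)}$ and $J'$ is the sum of $J^{(1')}(g)$ over all $g$ not in $J^{(1)\mathrm{sint}}$ whose support meets $\mathcal S_2$ and is contained in $\bar b^{(2)}$. In addition $J^{(2)\mathrm{sint}}$ contains the diagonal parts of $J^{(1')}(g)$ for external $g$ with $|g|=2$ and support disjoint from $\mathcal S_2$. $O^{(2)}$ is a product over the small blocks $b^{(2)}$ of orthogonal matrices, each changing only the spins in $\bar b^{(2)}$ and depending only on those in $\bar{\bar b}^{(2)}$, that diagonalize the diagonal matrix of the $E^{(1')}_\sigma$, plus these diagonal parts, plus the part of $J^{(2)\mathrm{sint}}$ in the block. Finally $$R^{(2')}=\Omega^{(1)}O^{(1)}\Omega^{(2)}O^{(2)} .$$ **Proposition 3.2.** Let $\rho_0$, $\nu>0$, $C$, $m_0$ be given. There are constants $c$ and $\gamma_0>0$, depending on these only, such that the following holds for all $0<\gamma<\gamma_0$ and all disorder distributions as above satisfying LLA$(\nu,C)$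 (at this $\gamma$), for every box $\Lambda$ and every choice of the rotations $O^{(1)},O^{(2)}$ for which $R^{(2')}$ is measurable in the disorder: $$\Big|\,\mathbb E\,\mathrm{Av}_\alpha\Big|\sum_{\sigma,\tilde\sigma}R^{(2')\mathrm{tr}}_{\alpha\sigma}(S^z_0)_{\sigma\tilde\sigma}R^{(2')}_{\tilde\sigma\alpha}\Big|-1\Big|\le c\,\varepsilon ,$$ the random variable under $\mathbb E$ being integrable. Here $\mathrm{Av}_\alpha$ is the average over the $2^{|\Lambda|}$ labels $\alpha$ with uniform weights or, more generally, with any measurable nonnegative weights of sum $1$, which may depend on the disorder (in particular on the energies). -/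

import Mathlib

open MeasureTheory ProbabilityTheory
open scoped Matrix

noncomputable section

namespace SpinChain

/-! ## The model -/

/-- The box `[-left, right] ∩ ℤ`; it always contains the site `0`. -/
structure Box where
  left : ℕ
  right : ℕ

/-- The sites of the box. -/
def Box.sites (Λ : Box) : Finset ℤ := Finset.Icc (-(Λ.left : ℤ)) (Λ.right : ℤ)

/-- Spin configurations in the box; they index the tensor product basis. -/
abbrev Config (Λ : Box) : Type := Λ.sites → ℤˣ

/-- Operators, as matrices in the tensor product basis (all matrices that occur are real). -/
abbrev Op (Λ : Box) : Type := Matrix (Config Λ) (Config Λ) ℝ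

/-- The coupling `γ` of the transverse term and one realization of the disorder. -/
structure Couplings where
  γ : ℝ
  h : ℤ → ℝ
  Γ : ℤ → ℝ
  J : ℤ → ℝ

/-- The resonance cutoff `ε = γ^(1/20)`. -/
def Couplings.ε (c : Couplings) : ℝ := c.γ ^ (1 / 20 : ℝ)

/-- The value `±1` of the spin at `i`, frozen to `+1` outside the box. -/
def spin {Λ : Box} (σ : Config Λ) (i : ℤ) : ℝ :=
  if hi : i ∈ Λ.sites then (((σ ⟨i, hi⟩ : ℤˣ) : ℤ) : ℝ) else 1

/-- The configuration with the spin at `i` flipped. -/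
def flip {Λ : Box} (σ : Config Λ) (i : ℤ) : Config Λ :=
  fun j => if (j : ℤ) = i then -σ j else σ j

/-- The Pauli matrix `S^z` at site `i`; it is the identity for `i` outside the box. -/
def Sz (Λ : Box) (i : ℤ) : Op Λ := Matrix.diagonal fun σ => spin σ i

/-- The Pauli matrix `S^x` at a site `i` of the box. -/
def Sx (Λ : Box) (i : ℤ) : Op Λ := fun σ τ => if τ = flip σ i then 1 else 0

/-- The Hamiltonian in the box, with `+` boundary conditions. -/
def hamiltonian (c : Couplings) (Λ : Box) : Op Λ :=
  ∑ i ∈ Λ.sites, c.h i • Sz Λ i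
    + ∑ i ∈ Λ.sites, (c.γ * c.Γ i) • Sx Λ i
    + ∑ i ∈ Finset.Icc (-(Λ.left : ℤ) - 1) (Λ.right : ℤ), c.J i • (Sz Λ i * Sz Λ (i + 1))

theorem flip_flip {Λ : Box} (σ : Config Λ) (i : ℤ) : flip (flip σ i) i = σ := by
  funext j
  by_cases hj : (j : ℤ) = i <;> simp [flip, hj]

theorem Sz_isHermitian (Λ : Box) (i : ℤ) : (Sz Λ i).IsHermitian := by
  simp [Matrix.IsHermitian, Sz]

theorem Sx_isHermitian (Λ : Box) (i : ℤ) : (Sx Λ i).IsHermitian := by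
  ext σ τ
  have : (σ = flip τ i) ↔ (τ = flip σ i) := by
    constructor <;> · rintro rfl; exact (flip_flip _ i).symm
  simp [Sx, this]

theorem hamiltonian_isHermitian (c : Couplings) (Λ : Box) : (hamiltonian c Λ).IsHermitian := by
  have hsmul : ∀ (r : ℝ) (M : Op Λ), M.IsHermitian → (r • M).IsHermitian := by
    intro r M hM
    rw [Matrix.IsHermitian, Matrix.conjTranspose_smul, hM.eq, star_trivial]
  have hsum : ∀ (s : Finset ℤ) (f : ℤ → Op Λ), (∀ i, (f i).IsHermitian) →
      (∑ i ∈ s, f i).IsHermitian := by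
    intro s f hf
    simp only [Matrix.IsHermitian, Matrix.conjTranspose_sum]
    exact Finset.sum_congr rfl fun i _ => (hf i).eq
  refine ((hsum _ _ fun i => hsmul _ _ (Sz_isHermitian Λ i)).add
    (hsum _ _ fun i => hsmul _ _ (Sx_isHermitian Λ i))).add (hsum _ _ fun i => hsmul _ _ ?_)
  simp [Matrix.IsHermitian, Sz, Matrix.diagonal_mul_diagonal]

/-- The diagonal entry `E(σ)` of the Hamiltonian. -/
def energy (c : Couplings) {Λ : Box} (σ : Config Λ) : ℝ :=
  ∑ i ∈ Λ.sites, c.h i * spin σ i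
    + ∑ i ∈ Finset.Icc (-(Λ.left : ℤ) - 1) (Λ.right : ℤ), c.J i * spin σ i * spin σ (i + 1)

/-! ## The disorder -/

/-- The random fields, random transverse fields and random exchange couplings, on all of `ℤ`. -/
structure RandomCouplings (Ω : Type*) where
  h : ℤ → Ω → ℝ
  Γ : ℤ → Ω → ℝ
  J : ℤ → Ω → ℝ

/-- All the random variables as a single family. -/
def RandomCouplings.family {Ω : Type*} (V : RandomCouplings Ω) (p : Fin 3 × ℤ) : Ω → ℝ :=
  ![V.h, V.Γ, V.J] p.1 p.2

/-- The realization at the sample point `ω`. -/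
def RandomCouplings.at {Ω : Type*} (V : RandomCouplings Ω) (γ : ℝ) (ω : Ω) : Couplings where
  γ := γ
  h := fun i => V.h i ω
  Γ := fun i => V.Γ i ω
  J := fun i => V.J i ω

/-- The standing assumptions on the disorder: all the variables are independent, bounded by `1`,
and have probability densities bounded by `ρ₀`. -/
structure IsDisorder {Ω : Type*} [MeasurableSpace Ω] (μ : Measure Ω) (ρ₀ : ℝ)
    (V : RandomCouplings Ω) : Prop where
  measurable : ∀ p, Measurable (V.family p)
  indep : iIndepFun V.family μ
  bounded : ∀ p, ∀ᵐ ω ∂μ, |V.family p ω| ≤ 1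
  density : ∀ p, ∃ f : ℝ → ENNReal, Measurable f ∧ (∀ x, f x ≤ ENNReal.ofReal ρ₀) ∧
    μ.map (V.family p) = volume.withDensity f

/-- Limited level attraction with exponent `ν` and constant `C`: in every box of `n` sites, the
probability that two eigenvalues of the Hamiltonian (counted with multiplicity) are closer
than `δ` is at most `δ^ν C^n`. -/
def LLA {Ω : Type*} [MeasurableSpace Ω] (μ : Measure Ω) (V : RandomCouplings Ω)
    (γ ν C : ℝ) : Prop :=
  ∀ (Λ : Box) (δ : ℝ), 0 < δ →
    μ {ω | ∃ α β, α ≠ β ∧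
      |(hamiltonian_isHermitian (V.at γ ω) Λ).eigenvalues α
        - (hamiltonian_isHermitian (V.at γ ω) Λ).eigenvalues β| < δ}
      ≤ ENNReal.ofReal (δ ^ ν * C ^ Λ.sites.card)

/-! ## Length scales, components, collars -/

/-- The length scales `L_k = (15/8)^k`. -/
def lengthScale (k : ℕ) : ℝ := (15 / 8 : ℝ) ^ k

/-- The separation distances `d_m = exp (L_{m + m₀}^(1/2))`. -/
def sepDist (m₀ m : ℕ) : ℝ := Real.exp (Real.sqrt (lengthScale (m + m₀)))

open Classical in
/-- The connected components of `T` for proximity connections of length at most `d`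
(`d = 1`: nearest-neighbor connections). -/
def components (d : ℝ) (T : Finset ℤ) : Finset (Finset ℤ) :=
  T.image fun x => T.filter fun y =>
    Relation.ReflTransGen (fun a b : ℤ => b ∈ T ∧ ((|a - b| : ℤ) : ℝ) ≤ d) x y

/-- The diameter of `X` is less than `d`. -/
def DiamLT (X : Finset ℤ) (d : ℝ) : Prop := ∀ x ∈ X, ∀ y ∈ X, ((|x - y| : ℤ) : ℝ) < d

open Classical in
/-- `X` together with its collar of `k` steps inside the box. -/
def collar (Λ : Box) (k : ℕ) (X : Finset ℤ) : Finset ℤ :=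
  Λ.sites.filter fun x => ∃ y ∈ X, |x - y| ≤ (k : ℤ)

/-! ## Step 1: resonant sites, small blocks -/

/-- Site `i` is resonant: for some choice of the spins, flipping the spin at `i` changes the
energy by less than `ε`. -/
def IsResonantSite (c : Couplings) (Λ : Box) (i : ℤ) : Prop :=
  ∃ σ : Config Λ, |energy c σ - energy c (flip σ i)| < c.ε

open Classical in
/-- The resonant set `𝒮₁`. -/
def S1 (c : Couplings) (Λ : Box) : Finset ℤ := Λ.sites.filter fun i => IsResonantSite c Λ i

open Classical in
/-- The small blocks `b⁽¹⁾`: the resonant blocks of diameter `< L₁` (that is, `0` or `1`) which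
are at distance `> d₁` from the other resonant blocks. -/
def small1 (m₀ : ℕ) (c : Couplings) (Λ : Box) : Finset (Finset ℤ) :=
  (components 1 (S1 c Λ)).filter fun b =>
    DiamLT b (lengthScale 1) ∧
      ∀ x ∈ b, ∀ y ∈ S1 c Λ \ b, sepDist m₀ 1 < ((|x - y| : ℤ) : ℝ)

/-- The collared small block `b̄⁽¹⁾`. -/
def bar1 (Λ : Box) (b : Finset ℤ) : Finset ℤ := collar Λ 1 b

/-- The small block with its second collar. -/
def barbar1 (Λ : Box) (b : Finset ℤ) : Finset ℤ := collar Λ 1 (bar1 Λ b)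

/-- The large block region `𝒮_{1'}` (without collar). -/
def S1large (m₀ : ℕ) (c : Couplings) (Λ : Box) : Finset ℤ :=
  S1 c Λ \ (small1 m₀ c Λ).biUnion id

/-- The collared resonant region. -/
def S1bar (c : Couplings) (Λ : Box) : Finset ℤ := collar Λ 1 (S1 c Λ)

/-! ## Step 1: generator, graphs -/

/-- The local interaction `J⁽⁰⁾(i) = γ_i S^x_i`. -/
def J0 (c : Couplings) (Λ : Box) (i : ℤ) : Op Λ := (c.γ * c.Γ i) • Sx Λ i

/-- The local generator `A(i)`, for `i ∉ 𝒮₁`. -/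
def A1 (c : Couplings) (Λ : Box) (i : ℤ) : Op Λ :=
  fun σ τ => if τ = flip σ i then c.γ * c.Γ i / (energy c σ - energy c τ) else 0

/-- The first basis change `Ω = exp (-A)`, `A = ∑_{i ∉ 𝒮₁} A(i)`. -/
def Omega1 (c : Couplings) (Λ : Box) : Op Λ :=
  NormedSpace.exp (-∑ i ∈ Λ.sites \ S1 c Λ, A1 c Λ i)

/-- An ordered product `A(l_a) ⋯ A(l_1) J⁽⁰⁾(center) A(r_1) ⋯ A(r_b)`, as obtained by expanding
the multiple commutators of `A` with `J⁽⁰⁾`. The lists `[l_1, …, l_a]` and `[r_1, …, r_b]` are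
read outwards from the center. -/
structure Word where
  outL : List ℤ
  center : ℤ
  outR : List ℤ

namespace Word

/-- The number `n` of commutators. -/
def order (w : Word) : ℕ := w.outL.length + w.outR.length

/-- The length `|g| = n + 1`, the number of operators in the product. -/
def length (w : Word) : ℕ := w.order + 1

/-- The sites at which the spin is flipped. -/
def sites (w : Word) : Finset ℤ := (w.outL ++ w.center :: w.outR).toFinset

/-- The configuration reached from `σ` by performing all the flips. -/
def walk {Λ : Box} (w : Word) (σ : Config Λ) : Config Λ :=
  (w.outL ++ w.center :: w.outR).foldl flip σ

end Word

open Classical in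
/-- The number of ways to interleave the two lists into a sequence `i_1, …, i_n` which is
admissible, meaning that each `i_p` is within distance `1` of the sites visited before it. -/
def interleavings (visited : Finset ℤ) : List ℤ → List ℤ → ℕ
  | [], [] => 1
  | l :: ls, [] =>
      if ∃ v ∈ visited, |l - v| ≤ 1 then interleavings (insert l visited) ls [] else 0
  | [], r :: rs =>
      if ∃ v ∈ visited, |r - v| ≤ 1 then interleavings (insert r visited) [] rs else 0
  | l :: ls, r :: rs =>
      (if ∃ v ∈ visited, |l - v| ≤ 1 then interleavings (insert l visited) ls (r :: rs) else 0)
        + (if ∃ v ∈ visited, |r - v| ≤ 1 then interleavings (insert r visited) (l :: ls) rs else 0)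
termination_by ls rs => ls.length + rs.length

/-- The number of admissible sequences `i_0, i_1, …, i_n` whose nested commutator contains the
given ordered product; it is the binomial coefficient `n choose b` if the order in which the
factors on the left and on the right are produced is not constrained by admissibility. -/
def Word.multiplicity (w : Word) : ℕ := interleavings {w.center} w.outL w.outR

/-- The graphs `g₁` of the interaction after the first basis change: ordered products that arise
from an admissible sequence, with all the sites of `A` factors nonresonant. Products of a single
factor are the terms of `J⁽⁰⁾ʳᵉˢ`. -/
def IsGraph (c : Couplings) (Λ : Box) (w : Word) : Prop :=
  w.sites ⊆ Λ.sites ∧ (∀ i ∈ w.outL ++ w.outR, i ∉ S1 c Λ) ∧ w.multiplicity ≠ 0 ∧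
    (w.order = 0 → w.center ∈ S1 c Λ)

open Classical in
/-- The term of `J⁽⁰⁾ʳᵉˢ + J⁽¹⁾` given by the graph `w`, the coefficients being those of
`∑_n (n/(n+1)!) (ad A)^n J⁽⁰⁾ᵖᵉʳ + ∑_n (1/n!) (ad A)^n J⁽⁰⁾ʳᵉˢ`. -/
def graphTerm (c : Couplings) (Λ : Box) (w : Word) : Op Λ :=
  ((w.multiplicity : ℝ) * (-1) ^ w.outR.length *
      (if w.center ∈ S1 c Λ then 1 / (w.order.factorial : ℝ)
        else (w.order : ℝ) / ((w.order + 1).factorial : ℝ))) •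
    ((w.outL.reverse.map (A1 c Λ)).prod * J0 c Λ w.center * (w.outR.map (A1 c Λ)).prod)

/-- The graphs of `J⁽¹⁾ˢⁱⁿᵗ` in the small block `b`: they intersect `𝒮₁` and are contained
in `b̄`. -/
def IsSmallInternal (c : Couplings) (Λ : Box) (b : Finset ℤ) (w : Word) : Prop :=
  IsGraph c Λ w ∧ ¬Disjoint w.sites (S1 c Λ) ∧ w.sites ⊆ bar1 Λ b

/-- The graphs of `J⁽¹⁾ᵉˣᵗ`: they do not intersect `𝒮₁` or are not contained in its collared
version. -/
def IsExternal (c : Couplings) (Λ : Box) (w : Word) : Prop :=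
  IsGraph c Λ w ∧ (Disjoint w.sites (S1 c Λ) ∨ ¬w.sites ⊆ S1bar c Λ)

open Classical in
/-- The part of `J⁽¹⁾ˢⁱⁿᵗ` in the small block `b`. -/
def J1sint (c : Couplings) (Λ : Box) (b : Finset ℤ) : Op Λ :=
  ∑' w : Word, if IsSmallInternal c Λ b w then graphTerm c Λ w else 0

/-! ## Block rotations -/

/-- `U` is an orthogonal matrix which diagonalizes `M`, acts on the spins in `X` only, and depends
on the spins in `Y` only. -/
structure IsBlockRotation {Λ : Box} (X Y : Finset ℤ) (M U : Op Λ) : Prop where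
  orthogonal : Uᵀ * U = 1
  acts : ∀ σ τ, U σ τ ≠ 0 → ∀ i : Λ.sites, (i : ℤ) ∉ X → σ i = τ i
  depends : ∀ σ τ σ' τ' : Config Λ,
    (∀ i : Λ.sites, (i : ℤ) ∈ Y → σ i = σ' i ∧ τ i = τ' i) →
    (∀ i : Λ.sites, (i : ℤ) ∉ X → σ i = τ i) → (∀ i : Λ.sites, (i : ℤ) ∉ X → σ' i = τ' i) →
    U σ τ = U σ' τ'
  diagonalizes : (Uᵀ * M * U).IsDiag

/-- `U b`, for the step 1 small blocks `b`, are block rotations which diagonalize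
`H₀ + J⁽¹⁾ˢⁱⁿᵗ` within the blocks. The choice of eigenvectors and their labeling are free. -/
def IsStep1Rotation (m₀ : ℕ) (c : Couplings) (Λ : Box) (U : Finset ℤ → Op Λ) : Prop :=
  ∀ b ∈ small1 m₀ c Λ, IsBlockRotation (bar1 Λ b) (barbar1 Λ b)
    (Matrix.diagonal (energy c) + J1sint c Λ b) (U b)

/-- The product of the block rotations of a family of blocks. The factors belong to
different tensor factors and commute, so that their order does not matter. -/
def blockProduct {Λ : Box} (B : Finset (Finset ℤ)) (U : Finset ℤ → Op Λ) : Op Λ :=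
  (B.toList.map U).prod

/-- The rotation `O⁽¹⁾`. -/
def O1 (m₀ : ℕ) (c : Couplings) (Λ : Box) (U : Finset ℤ → Op Λ) : Op Λ :=
  blockProduct (small1 m₀ c Λ) U

/-- The energies `E⁽¹'⁾`: the diagonal entries of
`H₀⁽¹'⁾ = O⁽¹⁾ᵗʳ (H₀ + J⁽¹⁾ˢⁱⁿᵗ) O⁽¹⁾`. -/
def energy1 (m₀ : ℕ) (c : Couplings) (Λ : Box) (U : Finset ℤ → Op Λ) (σ : Config Λ) : ℝ :=
  let H₀ : Op Λ := (O1 m₀ c Λ U)ᵀ *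
    (Matrix.diagonal (energy c) + ∑ b ∈ small1 m₀ c Λ, J1sint c Λ b) * O1 m₀ c Λ U
  H₀ σ σ

/-! ## Step 2: rotated graphs and resonances -/

open Classical in
/-- The small blocks touched by a graph: those with a flip of the graph in the twice collared
block. Conjugation with the rotations of the other blocks leaves the graph unchanged. -/
def touched (m₀ : ℕ) (c : Couplings) (Λ : Box) (w : Word) : Finset (Finset ℤ) :=
  (small1 m₀ c Λ).filter fun b => ¬Disjoint w.sites (barbar1 Λ b)

/-- The sites in the touched collared blocks `b̄⁽¹⁾`. -/
def touchedSites (m₀ : ℕ) (c : Couplings) (Λ : Box) (w : Word) : Finset ℤ :=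
  (touched m₀ c Λ w).biUnion (bar1 Λ)

/-- The sites and blocks that belong to the graph, as a set of sites. -/
def support (m₀ : ℕ) (c : Couplings) (Λ : Box) (w : Word) : Finset ℤ :=
  w.sites ∪ touchedSites m₀ c Λ w

/-- The rotations of the touched blocks. -/
def touchedRotation (m₀ : ℕ) (c : Couplings) (Λ : Box) (U : Finset ℤ → Op Λ) (w : Word) : Op Λ :=
  blockProduct (touched m₀ c Λ w) U

/-- The rotated term `O⁽¹⁾ᵗʳ J⁽¹⁾(w) O⁽¹⁾`. -/
def rotatedTerm (m₀ : ℕ) (c : Couplings) (Λ : Box) (U : Finset ℤ → Op Λ) (w : Word) : Op Λ :=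
  (touchedRotation m₀ c Λ U w)ᵀ * graphTerm c Λ w * touchedRotation m₀ c Λ U w

open Classical in
/-- The smallest interval covering the sites and twice collared blocks that contain flips of
the graph. -/
def graphInterval (m₀ : ℕ) (c : Couplings) (Λ : Box) (w : Word) : Finset ℤ :=
  Λ.sites.filter fun x =>
    (∃ y ∈ w.sites ∪ (touched m₀ c Λ w).biUnion (barbar1 Λ), y ≤ x) ∧
      ∃ y ∈ w.sites ∪ (touched m₀ c Λ w).biUnion (barbar1 Λ), x ≤ y

open Classical in
/-- The number of twice collared blocks in the interval of the graph plus the number of its sites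
not in such blocks. -/
def graphSpan (m₀ : ℕ) (c : Couplings) (Λ : Box) (w : Word) : ℕ :=
  ((graphInterval m₀ c Λ w).filter fun x => ∀ b ∈ small1 m₀ c Λ, x ∉ barbar1 Λ b).card
    + ((small1 m₀ c Λ).filter fun b => ¬Disjoint (barbar1 Λ b) (graphInterval m₀ c Λ w)).card

/-- A rotated graph `g_{1'} : α → β` is given by the graph `w`, the labels `α`, `β` and the
intermediate configurations `σ` and `w.walk σ`; `α`, `β` agree with these outside the touched
blocks. It is resonant in step 2 if it is off-diagonal, of length `2` or `3`, does not meet the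
large blocks of step 1, and satisfies one of the resonance conditions I, II. -/
def IsResonantGraph (m₀ : ℕ) (c : Couplings) (Λ : Box) (U : Finset ℤ → Op Λ) (w : Word)
    (α σ β : Config Λ) : Prop :=
  IsExternal c Λ w ∧ 2 ≤ w.length ∧ w.length ≤ 3 ∧
    Disjoint (support m₀ c Λ w) (S1large m₀ c Λ) ∧
    (∀ i : Λ.sites, (i : ℤ) ∉ touchedSites m₀ c Λ w → α i = σ i ∧ β i = w.walk σ i) ∧
    α ≠ β ∧
    (|energy1 m₀ c Λ U α - energy1 m₀ c Λ U β| < c.ε ^ w.length ∨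
      (|touchedRotation m₀ c Λ U w σ α * graphTerm c Λ w σ (w.walk σ)
            * touchedRotation m₀ c Λ U w (w.walk σ) β
          / (energy1 m₀ c Λ U α - energy1 m₀ c Λ U β)|
          > (c.γ / c.ε) ^ w.length / ((w.length - 1).factorial : ℝ) ^ (2 / 9 : ℝ) ∧
        (7 / 8 : ℝ) * w.length ≤ graphSpan m₀ c Λ w))

open Classical in
/-- The union of the step 2 resonant blocks `B⁽²⁾`. -/
def resonant2 (m₀ : ℕ) (c : Couplings) (Λ : Box) (U : Finset ℤ → Op Λ) : Finset ℤ :=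
  Λ.sites.filter fun x =>
    ∃ w, (∃ α σ β, IsResonantGraph m₀ c Λ U w α σ β) ∧ x ∈ support m₀ c Λ w

/-! ## Step 2: reorganization of the resonant region -/

/-- `X` is a step 1 small block which is not part of a step 2 resonant block. -/
def IsOldBlock (m₀ : ℕ) (c : Couplings) (Λ : Box) (U : Finset ℤ → Op Λ) (X : Finset ℤ) : Prop :=
  X ∈ small1 m₀ c Λ ∧ Disjoint X (resonant2 m₀ c Λ U)

open Classical in
/-- The size of a block: the number of its sites for a block `b⁽¹⁾`, otherwise the number of
sites and blocks `b̄⁽¹⁾` in it, but at least `2`. -/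
def blockSize (m₀ : ℕ) (c : Couplings) (Λ : Box) (U : Finset ℤ → Op Λ) (X : Finset ℤ) : ℕ :=
  if IsOldBlock m₀ c Λ U X then X.card
  else max 2 ((X \ (small1 m₀ c Λ).biUnion (bar1 Λ)).card
    + ((small1 m₀ c Λ).filter fun b => ¬Disjoint (bar1 Λ b) X).card)

open Classical in
/-- The small blocks of size `< L_m` and diameter `< L₂` among the components of `T` for proximity
connections on the scale `d_m`. -/
def extract (m₀ : ℕ) (c : Couplings) (Λ : Box) (U : Finset ℤ → Op Λ) (m : ℕ) (T : Finset ℤ) :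
    Finset (Finset ℤ) :=
  (components (sepDist m₀ m) T).filter fun X =>
    DiamLT X (lengthScale 2) ∧ (blockSize m₀ c Λ U X : ℝ) < lengthScale m

/-- What remains of the complete resonant region after the small blocks of size `< L_m` have been
extracted, on the successive scales `d_1, …, d_m`. -/
def remaining (m₀ : ℕ) (c : Couplings) (Λ : Box) (U : Finset ℤ → Op Λ) : ℕ → Finset ℤ
  | 0 => S1 c Λ ∪ resonant2 m₀ c Λ U
  | m + 1 => remaining m₀ c Λ U m
      \ (extract m₀ c Λ U (m + 1) (remaining m₀ c Λ U m)).biUnion id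

/-- The large block region `𝒮_{2'}` (without collar). A block of diameter `< L₂` has at most four
sites, and `4 < L₃`, so that there are no further small blocks after the scale `d₃`. -/
def S2large (m₀ : ℕ) (c : Couplings) (Λ : Box) (U : Finset ℤ → Op Λ) : Finset ℤ :=
  remaining m₀ c Λ U 3

open Classical in
/-- The new small blocks `b⁽²⁾`: the extracted blocks other than those kept from step 1. -/
def small2 (m₀ : ℕ) (c : Couplings) (Λ : Box) (U : Finset ℤ → Op Λ) : Finset (Finset ℤ) :=
  ((Finset.range 3).biUnion fun m =>
    extract m₀ c Λ U (m + 1) (remaining m₀ c Λ U m)).filter fun X => ¬IsOldBlock m₀ c Λ U X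

/-- The region `𝒮₂`: the large block region and the small blocks `b⁽²⁾`. -/
def S2 (m₀ : ℕ) (c : Couplings) (Λ : Box) (U : Finset ℤ → Op Λ) : Finset ℤ :=
  S2large m₀ c Λ U ∪ (small2 m₀ c Λ U).biUnion id

open Classical in
/-- The distance `|x - y|⁽¹⁾`, in which the twice collared blocks of step 1 are contracted
to points. -/
def dist1 (m₀ : ℕ) (c : Couplings) (Λ : Box) (x y : ℤ) : ℕ :=
  ((Finset.Ico (min x y) (max x y)).filter fun k =>
    ∀ b ∈ small1 m₀ c Λ, ¬(k ∈ barbar1 Λ b ∧ k + 1 ∈ barbar1 Λ b)).card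

open Classical in
/-- `X` together with its collar of `k` steps, measured in `|x - y|⁽¹⁾`. -/
def collar1 (m₀ : ℕ) (c : Couplings) (Λ : Box) (k : ℕ) (X : Finset ℤ) : Finset ℤ :=
  Λ.sites.filter fun x => ∃ y ∈ X, dist1 m₀ c Λ x y ≤ k

/-- The collared small block `b̄⁽²⁾`, with a collar of three steps. -/
def bar2 (m₀ : ℕ) (c : Couplings) (Λ : Box) (b : Finset ℤ) : Finset ℤ := collar1 m₀ c Λ 3 b

/-- The small block `b⁽²⁾` with its second collar, of width `15/14 L₁`, that is, two steps. -/
def barbar2 (m₀ : ℕ) (c : Couplings) (Λ : Box) (b : Finset ℤ) : Finset ℤ :=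
  collar1 m₀ c Λ 2 (bar2 m₀ c Λ b)

/-! ## Step 2: generator and rotation -/

/-- The graphs of `J⁽¹'⁾ᵖᵉʳ` (whose off-diagonal entries are used): length `2` or `3` and all
sites and blocks outside `𝒮₂`. -/
def IsPerturbative (m₀ : ℕ) (c : Couplings) (Λ : Box) (U : Finset ℤ → Op Λ) (w : Word) : Prop :=
  IsExternal c Λ w ∧ 2 ≤ w.length ∧ w.length ≤ 3 ∧
    Disjoint (support m₀ c Λ w) (S2 m₀ c Λ U)

/-- The contribution of the graph `w` to the generator `A⁽²⁾`. -/
def A2term (m₀ : ℕ) (c : Couplings) (Λ : Box) (U : Finset ℤ → Op Λ) (w : Word) : Op Λ :=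
  fun α β => if α = β then 0
    else rotatedTerm m₀ c Λ U w α β / (energy1 m₀ c Λ U α - energy1 m₀ c Λ U β)

open Classical in
/-- The generator `A⁽²⁾`. -/
def A2 (m₀ : ℕ) (c : Couplings) (Λ : Box) (U : Finset ℤ → Op Λ) : Op Λ :=
  ∑' w : Word, if IsPerturbative m₀ c Λ U w then A2term m₀ c Λ U w else 0

/-- The basis change `Ω⁽²⁾ = exp (-A⁽²⁾)`. -/
def Omega2 (m₀ : ℕ) (c : Couplings) (Λ : Box) (U : Finset ℤ → Op Λ) : Op Λ :=
  NormedSpace.exp (-A2 m₀ c Λ U)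

open Classical in
/-- The part of `A⁽²⁾` given by graphs contained in `X`. -/
def A2in (m₀ : ℕ) (c : Couplings) (Λ : Box) (U : Finset ℤ → Op Λ) (X : Finset ℤ) : Op Λ :=
  ∑' w : Word, if IsPerturbative m₀ c Λ U w ∧ support m₀ c Λ w ⊆ X then A2term m₀ c Λ U w else 0

open Classical in
/-- The part of `J⁽¹'⁾ʳᵉˢ + J⁽¹⁾ˡⁱⁿᵗ` given by graphs which intersect `𝒮₂` and are contained
in `X`; these are all the terms except those of `J⁽¹⁾ˢⁱⁿᵗ`, already diagonalized in step 1. -/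
def J1in (m₀ : ℕ) (c : Couplings) (Λ : Box) (U : Finset ℤ → Op Λ) (X : Finset ℤ) : Op Λ :=
  ∑' w : Word,
    if IsGraph c Λ w ∧ (∀ b ∈ small1 m₀ c Λ, ¬IsSmallInternal c Λ b w) ∧
        ¬Disjoint (support m₀ c Λ w) (S2 m₀ c Λ U) ∧ support m₀ c Λ w ⊆ X
      then rotatedTerm m₀ c Λ U w else 0

/-- The part of `J⁽²⁾ˢⁱⁿᵗ` in the small block `b⁽²⁾`: the sum of all the terms of
`∑_n (1/n!) (ad A⁽²⁾)^n (J⁽¹'⁾ʳᵉˢ + J⁽¹⁾ˡⁱⁿᵗ)` whose graph intersects `𝒮₂` and is contained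
in `b̄⁽²⁾`. The graphs of `A⁽²⁾` and of `J⁽¹'⁾ᵖᵉʳ` do not intersect `𝒮₂`. -/
def J2sint (m₀ : ℕ) (c : Couplings) (Λ : Box) (U : Finset ℤ → Op Λ) (b : Finset ℤ) : Op Λ :=
  ∑' n : ℕ, (1 / (n.factorial : ℝ)) •
    (fun M : Op Λ => A2in m₀ c Λ U (bar2 m₀ c Λ b) * M - M * A2in m₀ c Λ U (bar2 m₀ c Λ b))^[n]
      (J1in m₀ c Λ U (bar2 m₀ c Λ b))

open Classical in
/-- The second order diagonal terms for sites outside `𝒮₂`, which are part of `J⁽²⁾ˢⁱⁿᵗ`. -/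
def diag2 (m₀ : ℕ) (c : Couplings) (Λ : Box) (U : Finset ℤ → Op Λ) : Op Λ :=
  ∑' w : Word,
    if IsExternal c Λ w ∧ w.length = 2 ∧ Disjoint (support m₀ c Λ w) (S2 m₀ c Λ U)
      then Matrix.diagonal (fun σ => rotatedTerm m₀ c Λ U w σ σ) else 0

/-- `U' b`, for the step 2 small blocks `b`, are block rotations which diagonalize
`H₀⁽¹'⁾ + J⁽²⁾ˢⁱⁿᵗ` within the blocks. -/
def IsStep2Rotation (m₀ : ℕ) (c : Couplings) (Λ : Box) (U U' : Finset ℤ → Op Λ) : Prop :=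
  ∀ b ∈ small2 m₀ c Λ U, IsBlockRotation (bar2 m₀ c Λ b) (barbar2 m₀ c Λ b)
    (Matrix.diagonal (energy1 m₀ c Λ U) + diag2 m₀ c Λ U + J2sint m₀ c Λ U b) (U' b)

/-- The rotation `O⁽²⁾`. -/
def O2 (m₀ : ℕ) (c : Couplings) (Λ : Box) (U U' : Finset ℤ → Op Λ) : Op Λ :=
  blockProduct (small2 m₀ c Λ U) U'

/-- The cumulative rotation `R⁽²'⁾ = Ω⁽¹⁾ O⁽¹⁾ Ω⁽²⁾ O⁽²⁾`, whose columns are the step 2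
approximate eigenvectors. -/
def R2 (m₀ : ℕ) (c : Couplings) (Λ : Box) (U U' : Finset ℤ → Op Λ) : Op Λ :=
  Omega1 c Λ * O1 m₀ c Λ U * Omega2 m₀ c Λ U * O2 m₀ c Λ U U'

/-- The average, with weights `p`, of the modulus of the expectation of `S^z_0` in the columns
of `R`. -/
def averageSz {Λ : Box} (p : Config Λ → ℝ) (R : Op Λ) : ℝ :=
  ∑ α, p α * |(Rᵀ * Sz Λ 0 * R) α α|

end SpinChain

end

/-! The upper bound is deterministic: the rotation is orthogonal and `S^z_0` has norm one, so every
weighted average of moduli of diagonal entries is at most `1`. For the lower bound it suffices that,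
off an event `D` of probability `O(ε)`, conjugation with the rotation moves `S^z_0` by `O(γ/ε)` in
operator norm. Each diagonal entry then has modulus at least `1 - O(γ/ε)`, whatever the weights, and
`γ/ε = ε^19 ≤ ε`. On `D` the average is merely nonnegative.

The event `D` contains all the disorder for which some change of the spins within distance 12 of the
origin costs an energy less than `4ε`. Such an energy difference is a linear form in the disorder
whose coefficients depend only on the two spin patterns in a fixed window, and the field at a site
where the patterns differ has coefficient `±2`. Bounded densities and a union bound over the pairs
of patterns, whose number does not depend on the box, give the probability
(`exists_measurableSet_not_isGood`).

Off `D` there is no resonant site within distance 12, and the twice collared small blocks stay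
beyond distance 10. A graph of length at most 3 whose support meets `[-3, 3]` has its flips in `[-7,
7]` and touches no block. Such flips change the block energies exactly as they change `E`
(`energy1_sub`), so the gap `4ε` survives and rules out step 2 resonances near the origin
(`IsGood.lt_abs_of_mem_resonant2`). Hence no collared block of either step contains the origin, and
both block rotations commute with `S^z_0`.

The generators are antisymmetric, so their exponentials move `S^z_0` by at most the norm of a
commutator (`norm_exp_conj_sub_le`). By locality only boundedly many terms, each `O(γ/ε)`,
contribute to it (`norm_commutator_A1_sum_le`, `IsGood.norm_commutator_A2_le`). -/

noncomputable section

namespace SpinChain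

open scoped Matrix.Norms.L2Operator

/-! ### Operator norm, orthogonal matrices and exponentials -/

section Matrices

/-- `M` maps basis vectors to multiples, by at most `C`, of basis vectors. -/
def IsMonomial {n : Type*} (f : n → n) (C : ℝ) (M : Matrix n n ℝ) : Prop :=
  ∀ i j, |M i j| ≤ C ∧ (M i j ≠ 0 → j = f i)

/-- Only the intermediate index `f i` contributes to the product, so bounds multiply without any
factor from the dimension. -/
theorem IsMonomial.mul {n : Type*} [Fintype n] {f g : n → n} {C D : ℝ} {M N : Matrix n n ℝ}
    (hM : IsMonomial f C M) (hN : IsMonomial g D N) : IsMonomial (g ∘ f) (C * D) (M * N) := by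
  intro i j
  have h : (M * N) i j = M i (f i) * N (f i) j := by
    rw [Matrix.mul_apply]
    refine Finset.sum_eq_single _ (fun k _ hk => ?_) (by simp)
    by_contra hne
    exact hk ((hM i k).2 (left_ne_zero_of_mul hne))
  rw [h, abs_mul]
  refine ⟨mul_le_mul (hM _ _).1 (hN _ _).1 (abs_nonneg _) ((abs_nonneg _).trans (hM i i).1),
    fun hne => (hN _ _).2 (right_ne_zero_of_mul hne)⟩

theorem isMonomial_one {n : Type*} [DecidableEq n] : IsMonomial id 1 (1 : Matrix n n ℝ) := by
  intro i j
  by_cases h : i = j <;> simp [Matrix.one_apply, h, eq_comm]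

theorem IsMonomial.smul {n : Type*} {f : n → n} {C : ℝ} {M : Matrix n n ℝ}
    (hM : IsMonomial f C M) (r : ℝ) :
    IsMonomial f (|r| * C) (r • M) := by
  intro i j
  rw [Matrix.smul_apply, smul_eq_mul, abs_mul]
  exact ⟨mul_le_mul_of_nonneg_left (hM i j).1 (abs_nonneg r),
    fun h => (hM i j).2 (right_ne_zero_of_mul h)⟩

variable {n : Type*} [Fintype n] [DecidableEq n]

theorem mem_unitary_of_transpose_mul {U : Matrix n n ℝ} (h : Uᵀ * U = 1) :
    U ∈ unitary (Matrix n n ℝ) := by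
  have hs : star U = Uᵀ := by
    rw [Matrix.star_eq_conjTranspose, Matrix.conjTranspose_eq_transpose_of_trivial]
  rw [Unitary.mem_iff, hs]
  exact ⟨h, mul_eq_one_comm.mp h⟩

theorem transpose_mem_unitary {U : Matrix n n ℝ} (h : Uᵀ * U = 1) :
    Uᵀ ∈ unitary (Matrix n n ℝ) :=
  mem_unitary_of_transpose_mul (by rw [Matrix.transpose_transpose]; exact mul_eq_one_comm.mp h)

theorem transpose_mul_mul {U V : Matrix n n ℝ} (hU : Uᵀ * U = 1) (hV : Vᵀ * V = 1) :
    (U * V)ᵀ * (U * V) = 1 := by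
  rw [Matrix.transpose_mul, Matrix.mul_assoc, ← Matrix.mul_assoc Uᵀ, hU, Matrix.one_mul, hV]

theorem norm_conj_of_orthogonal {U : Matrix n n ℝ} (h : Uᵀ * U = 1) (M : Matrix n n ℝ) :
    ‖Uᵀ * M * U‖ = ‖M‖ := by
  rw [CStarRing.norm_mul_mem_unitary _ (mem_unitary_of_transpose_mul h),
    CStarRing.norm_mem_unitary_mul _ (transpose_mem_unitary h)]

theorem abs_entry_le_norm (M : Matrix n n ℝ) (i j : n) : |M i j| ≤ ‖M‖ := by
  have h := M.l2_opNorm_mulVec (EuclideanSpace.single j 1)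
  rw [PiLp.norm_single, norm_one, mul_one] at h
  refine le_trans ?_ h
  have := PiLp.norm_apply_le ((EuclideanSpace.equiv n ℝ).symm
    (M *ᵥ (EuclideanSpace.single j (1 : ℝ)).ofLp)) i
  simpa using this

theorem exp_orthogonal {A : Matrix n n ℝ} (hA : Aᵀ = -A) :
    (NormedSpace.exp A)ᵀ * NormedSpace.exp A = 1 := by
  rw [← Matrix.exp_transpose, hA, ← Matrix.exp_add_of_commute _ _ ((Commute.refl A).neg_left),
    neg_add_cancel, NormedSpace.exp_zero]

/-- Conjugation with the exponential of an antisymmetric matrix moves `S` by at most the norm of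
the commutator. -/
theorem norm_exp_conj_sub_le {A : Matrix n n ℝ} (hA : Aᵀ = -A) (S : Matrix n n ℝ) :
    ‖(NormedSpace.exp (-A))ᵀ * S * NormedSpace.exp (-A) - S‖ ≤ ‖A * S - S * A‖ := by
  have hE : ∀ t : ℝ, (NormedSpace.exp (t • -A))ᵀ = NormedSpace.exp (t • A) := by
    intro t
    rw [← Matrix.exp_transpose, Matrix.transpose_smul, Matrix.transpose_neg, hA, neg_neg]
  have hd : ∀ t : ℝ, HasDerivAt
      (fun u : ℝ => NormedSpace.exp (u • A) * S * NormedSpace.exp (u • -A))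
      (NormedSpace.exp (t • A) * (A * S - S * A) * NormedSpace.exp (t • -A)) t := by
    intro t
    have h1 := hasDerivAt_exp_smul_const (𝕂 := ℝ) A t
    have h2 := hasDerivAt_exp_smul_const' (𝕂 := ℝ) (-A) t
    have h3 := (h1.mul_const S).mul h2
    refine h3.congr_deriv ?_
    noncomm_ring
  -- Mean value inequality on `[0, 1]`: the derivative is the commutator conjugated by an orthogonal
  -- matrix, so its norm does not depend on `t`.
  have := norm_image_sub_le_of_norm_deriv_le_segment_01'
    (f := fun u : ℝ => NormedSpace.exp (u • A) * S * NormedSpace.exp (u • -A))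
    (C := ‖A * S - S * A‖) (fun t _ => (hd t).hasDerivWithinAt) (fun t _ => by
      rw [← hE, norm_conj_of_orthogonal]
      refine exp_orthogonal ?_
      rw [Matrix.transpose_smul, Matrix.transpose_neg, hA, smul_neg])
  have hE1 := hE 1
  rw [one_smul, one_smul] at hE1
  simpa [hE1] using this

/-- For injective `f` the matrix is a diagonal matrix times a permutation matrix, so its norm is the
largest entry. This keeps the estimates independent of the dimension `2^|Λ|`. -/
theorem IsMonomial.norm_le {f : n → n} (hf : Function.Injective f) {C : ℝ} (hC : 0 ≤ C)
    {M : Matrix n n ℝ} (hM : IsMonomial f C M) : ‖M‖ ≤ C := by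
  set e : Equiv.Perm n := Equiv.ofBijective f (Finite.injective_iff_bijective.mp hf)
  have he : ∀ i, e i = f i := fun i => rfl
  set P : Matrix n n ℝ := fun i j => if j = f i then 1 else 0 with hP
  have hPo : Pᵀ * P = 1 := by
    ext i j
    rw [Matrix.mul_apply, Finset.sum_eq_single (e.symm i)]
    · rw [Matrix.transpose_apply, Matrix.one_apply]
      simp only [hP, ← he, Equiv.apply_symm_apply, if_true, one_mul, eq_comm]
    · intro k _ hk
      have : i ≠ f k := by
        rintro rfl
        exact hk (by rw [← he, Equiv.symm_apply_apply])
      rw [Matrix.transpose_apply]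
      simp [hP, this]
    · simp
  have hMP : M = Matrix.diagonal (fun i => M i (f i)) * P := by
    ext i j
    rw [Matrix.diagonal_mul]
    by_cases h : j = f i
    · simp [hP, h]
    · simp only [hP, h, if_false, mul_zero]
      by_contra hne
      exact h ((hM i j).2 hne)
  rw [hMP, CStarRing.norm_mul_mem_unitary _ (mem_unitary_of_transpose_mul hPo),
    Matrix.l2_opNorm_diagonal]
  exact (pi_norm_le_iff_of_nonneg hC).mpr fun i => (hM _ _).1

theorem norm_commutator_le {M S : Matrix n n ℝ} (hS : ‖S‖ ≤ 1) : ‖M * S - S * M‖ ≤ 2 * ‖M‖ := by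
  have h1 : ‖M * S‖ ≤ ‖M‖ :=
    (norm_mul_le _ _).trans (mul_le_of_le_one_right (norm_nonneg _) hS)
  have h2 : ‖S * M‖ ≤ ‖M‖ :=
    (norm_mul_le _ _).trans (mul_le_of_le_one_left (norm_nonneg _) hS)
  calc ‖M * S - S * M‖ ≤ ‖M * S‖ + ‖S * M‖ := norm_sub_le _ _
    _ ≤ 2 * ‖M‖ := by linarith

end Matrices

/-! ### Small values of linear forms in the disorder -/

section Probability

variable {Ω : Type*} [MeasurableSpace Ω] {μ : Measure Ω}

/-- Fubini for the joint law: with `Y` fixed, `X` is confined to an interval of length at most `2δ`,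
because `|a| ≥ 1`, and its density is at most `ρ`. -/
theorem measure_abs_mul_add_lt_le [IsProbabilityMeasure μ] {X Y : Ω → ℝ} (hX : Measurable X)
    (hY : Measurable Y) (hXY : IndepFun X Y μ) {ρ : ℝ} {f : ℝ → ENNReal}
    (hf : ∀ x, f x ≤ ENNReal.ofReal ρ) (hXf : μ.map X = volume.withDensity f)
    {a : ℝ} (ha : 1 ≤ |a|) {δ : ℝ} (hδ : 0 ≤ δ) :
    μ {ω | |a * X ω + Y ω| < δ} ≤ ENNReal.ofReal ρ * ENNReal.ofReal (2 * δ) := by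
  have ha0 : a ≠ 0 := by
    rintro rfl
    norm_num at ha
  set s : Set (ℝ × ℝ) := {q | |a * q.1 + q.2| < δ} with hs
  have hsm : MeasurableSet s := measurableSet_lt (by fun_prop) measurable_const
  have h1 : μ {ω | |a * X ω + Y ω| < δ} = (μ.map fun ω => (X ω, Y ω)) s := by
    rw [Measure.map_apply (hX.prodMk hY) hsm]
    rfl
  rw [h1, (indepFun_iff_map_prod_eq_prod_map_map hX.aemeasurable hY.aemeasurable).mp hXY]
  have : IsProbabilityMeasure (μ.map Y) := Measure.isProbabilityMeasure_map hY.aemeasurable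
  have : IsProbabilityMeasure (μ.map X) := Measure.isProbabilityMeasure_map hX.aemeasurable
  rw [Measure.prod_apply_symm hsm]
  have h2 : ∀ y, (μ.map X) ((fun x => (x, y)) ⁻¹' s)
      ≤ ENNReal.ofReal ρ * ENNReal.ofReal (2 * δ) := by
    intro y
    have hsub : (fun x => (x, y)) ⁻¹' s ⊆ Metric.ball (-y / a) δ := by
      intro x hx
      have hx' : |a * x + y| < δ := hx
      rw [Metric.mem_ball, Real.dist_eq]
      have : a * x + y = a * (x - -y / a) := by field_simp; ring
      rw [this, abs_mul] at hx'
      nlinarith [abs_nonneg (x - -y / a)]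
    have hmeas : MeasurableSet ((fun x => (x, y)) ⁻¹' s) := measurable_prodMk_right hsm
    rw [hXf, withDensity_apply _ hmeas]
    calc ∫⁻ x in (fun x => (x, y)) ⁻¹' s, f x
        ≤ ∫⁻ _ in (fun x => (x, y)) ⁻¹' s, ENNReal.ofReal ρ := lintegral_mono fun x => hf x
      _ = ENNReal.ofReal ρ * volume ((fun x => (x, y)) ⁻¹' s) := by
          rw [setLIntegral_const]
      _ ≤ ENNReal.ofReal ρ * volume (Metric.ball (-y / a) δ) := by gcongr
      _ = _ := by rw [Real.volume_ball]
  calc ∫⁻ y, (μ.map X) ((fun x => (x, y)) ⁻¹' s) ∂(μ.map Y)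
      ≤ ∫⁻ _, ENNReal.ofReal ρ * ENNReal.ofReal (2 * δ) ∂(μ.map Y) := lintegral_mono h2
    _ = _ := by rw [lintegral_const, measure_univ, mul_one]

/-- One variable with coefficient at least `1` suffices: the rest of the sum is independent of it
and acts as a random shift. -/
theorem IsDisorder.measure_abs_sum_lt_le [IsProbabilityMeasure μ] {ρ₀ : ℝ}
    {V : RandomCouplings Ω} (hV : IsDisorder μ ρ₀ V) (S : Finset (Fin 3 × ℤ))
    (a : Fin 3 × ℤ → ℝ) {q : Fin 3 × ℤ} (hq : q ∈ S) (ha : 1 ≤ |a q|) {δ : ℝ} (hδ : 0 ≤ δ) :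
    μ {ω | |∑ p ∈ S, a p * V.family p ω| < δ} ≤ ENNReal.ofReal (2 * |ρ₀| * δ) := by
  classical
  obtain ⟨f, -, hf, hXf⟩ := hV.density q
  have hind : IndepFun (V.family q) (fun ω => ∑ p ∈ S.erase q, a p * V.family p ω) μ := by
    have h := hV.indep.indepFun_finset {q} (S.erase q) (by simp) hV.measurable
    have hφ : Measurable fun x : ↥({q} : Finset (Fin 3 × ℤ)) → ℝ => x ⟨q, by simp⟩ :=
      measurable_pi_apply _
    have hψ : Measurable fun y : ↥(S.erase q) → ℝ => ∑ p : ↥(S.erase q), a p * y p := by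
      fun_prop
    have h' := h.comp hφ hψ
    convert h' using 1
    · rfl
    funext ω
    exact (Finset.sum_coe_sort (S.erase q) fun p => a p * V.family p ω).symm
  have hmeas : Measurable fun ω => ∑ p ∈ S.erase q, a p * V.family p ω :=
    Finset.measurable_sum _ fun p _ => (hV.measurable p).const_mul _
  have h := measure_abs_mul_add_lt_le (hV.measurable q) hmeas hind hf hXf ha hδ
  have hsum : ∀ ω, a q * V.family q ω + ∑ p ∈ S.erase q, a p * V.family p ω
      = ∑ p ∈ S, a p * V.family p ω := fun ω =>
    Finset.add_sum_erase S (fun p => a p * V.family p ω) hq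
  simp only [hsum] at h
  refine h.trans ?_
  rw [mul_comm 2 |ρ₀|, mul_assoc, ENNReal.ofReal_mul (abs_nonneg _)]
  gcongr
  exact le_abs_self _

end Probability

end SpinChain
end

noncomputable section

namespace SpinChain

/-! ### Spins and energy differences -/

section Energies

variable {Λ : Box}

theorem spin_congr {σ τ : Config Λ} {i : ℤ} (h : ∀ hi : i ∈ Λ.sites, σ ⟨i, hi⟩ = τ ⟨i, hi⟩) :
    spin σ i = spin τ i := by
  unfold spin
  split_ifs with hi
  · rw [h hi]
  · rfl

theorem spin_of_notMem (σ : Config Λ) {i : ℤ} (hi : i ∉ Λ.sites) : spin σ i = 1 := by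
  simp [spin, hi]

theorem spin_of_mem (σ : Config Λ) (i : Λ.sites) : spin σ i = ((σ i : ℤ) : ℝ) := by
  simp [spin]

theorem spin_eq_one_or (σ : Config Λ) (i : ℤ) : spin σ i = 1 ∨ spin σ i = -1 := by
  by_cases hi : i ∈ Λ.sites
  · rw [spin_of_mem σ ⟨i, hi⟩]
    rcases Int.units_eq_one_or (σ ⟨i, hi⟩) with h | h <;> simp [h]
  · exact Or.inl (spin_of_notMem σ hi)

theorem eq_of_spin_eq {σ τ : Config Λ} {i : Λ.sites} (h : spin σ i = spin τ i) : σ i = τ i := by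
  rw [spin_of_mem, spin_of_mem] at h
  exact Units.ext (by exact_mod_cast h)

theorem energy_sub (c : Couplings) (σ τ : Config Λ) :
    energy c σ - energy c τ = ∑ i ∈ Λ.sites, c.h i * (spin σ i - spin τ i)
      + ∑ i ∈ Finset.Icc (-(Λ.left : ℤ) - 1) (Λ.right : ℤ),
        c.J i * (spin σ i * spin σ (i + 1) - spin τ i * spin τ (i + 1)) := by
  simp only [energy, mul_sub, Finset.sum_sub_distrib, mul_assoc]
  ring

/-- The change of energy caused by a change of the spins in `F` depends only on the spins at
distance at most `1` from `F`. -/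
theorem energy_sub_congr (c : Couplings) {σ τ σ' τ' : Config Λ} (F : Set ℤ)
    (h : ∀ i : Λ.sites, (i : ℤ) ∉ F → σ i = τ i)
    (h' : ∀ i : Λ.sites, (i : ℤ) ∉ F → σ' i = τ' i)
    (hF : ∀ i : Λ.sites, (∃ k ∈ F, |(i : ℤ) - k| ≤ 1) → σ i = σ' i ∧ τ i = τ' i) :
    energy c σ - energy c τ = energy c σ' - energy c τ' := by
  have hs : ∀ i : ℤ, i ∉ F → spin σ i = spin τ i := fun i hi =>
    spin_congr fun hm => h ⟨i, hm⟩ hi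
  have hs' : ∀ i : ℤ, i ∉ F → spin σ' i = spin τ' i := fun i hi =>
    spin_congr fun hm => h' ⟨i, hm⟩ hi
  have hn : ∀ i k : ℤ, k ∈ F → |i - k| ≤ 1 → spin σ i = spin σ' i ∧ spin τ i = spin τ' i :=
    fun i k hk hik => ⟨spin_congr fun hm => (hF ⟨i, hm⟩ ⟨k, hk, hik⟩).1,
      spin_congr fun hm => (hF ⟨i, hm⟩ ⟨k, hk, hik⟩).2⟩
  rw [energy_sub, energy_sub]
  congr 1
  · refine Finset.sum_congr rfl fun i _ => ?_
    by_cases hi : i ∈ F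
    · obtain ⟨h1, h2⟩ := hn i i hi (by simp)
      rw [h1, h2]
    · rw [hs i hi, hs' i hi, sub_self, sub_self]
  · refine Finset.sum_congr rfl fun i _ => ?_
    by_cases hi : i ∈ F
    · obtain ⟨h1, h2⟩ := hn i i hi (by simp)
      obtain ⟨h3, h4⟩ := hn (i + 1) i hi (by simp)
      rw [h1, h2, h3, h4]
    · by_cases hi1 : i + 1 ∈ F
      · obtain ⟨h1, h2⟩ := hn i (i + 1) hi1 (by simp)
        obtain ⟨h3, h4⟩ := hn (i + 1) (i + 1) hi1 (by simp)
        rw [h1, h2, h3, h4]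
      · rw [hs i hi, hs' i hi, hs _ hi1, hs' _ hi1, sub_self, sub_self]

end Energies

/-! ### Flips along a list of sites -/

section Flips

variable {Λ : Box}

/-- A list of flips multiplies each spin by a sign determined by a count. Commutation, involutivity
and independence of the order all follow from this. -/
theorem foldl_flip_apply (l : List ℤ) (σ : Config Λ) (j : Λ.sites) :
    l.foldl flip σ j = (-1) ^ l.count (j : ℤ) * σ j := by
  induction l generalizing σ with
  | nil => simp
  | cons i l ih =>
    rw [List.foldl_cons, ih]
    by_cases hij : (j : ℤ) = i
    · subst hij
      simp [flip, pow_succ]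
    · rw [List.count_cons_of_ne (Ne.symm hij)]
      simp [flip, hij]

theorem foldl_flip_apply_of_notMem {l : List ℤ} (σ : Config Λ) {j : Λ.sites}
    (hj : (j : ℤ) ∉ l) : l.foldl flip σ j = σ j := by
  rw [foldl_flip_apply, List.count_eq_zero_of_not_mem hj, pow_zero, one_mul]

theorem foldl_flip_comm (l l' : List ℤ) (σ : Config Λ) :
    l.foldl flip (l'.foldl flip σ) = l'.foldl flip (l.foldl flip σ) := by
  funext j
  simp only [foldl_flip_apply]
  exact mul_left_comm _ _ _

theorem foldl_flip_involutive (l : List ℤ) :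
    Function.Involutive fun σ : Config Λ => l.foldl flip σ := by
  intro σ
  funext j
  simp only [foldl_flip_apply]
  rw [← mul_assoc, ← mul_pow]
  simp

theorem foldl_flip_perm {l l' : List ℤ} (h : l.Perm l') (σ : Config Λ) :
    l.foldl flip σ = l'.foldl flip σ := by
  funext j
  rw [foldl_flip_apply, foldl_flip_apply, h.count_eq]

theorem foldl_flip_congr (l : List ℤ) {σ τ : Config Λ} {j : Λ.sites} :
    l.foldl flip σ j = l.foldl flip τ j ↔ σ j = τ j := by
  rw [foldl_flip_apply, foldl_flip_apply, mul_right_inj]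

/-- The flips at the sites of a list, as a permutation of the configurations. -/
def flipPerm (Λ : Box) (l : List ℤ) : Equiv.Perm (Config Λ) :=
  (foldl_flip_involutive l).toPerm _

theorem flipPerm_apply (l : List ℤ) (σ : Config Λ) : flipPerm Λ l σ = l.foldl flip σ := rfl

theorem Word.mem_sites {w : Word} {i : ℤ} : i ∈ w.sites ↔ i ∈ w.outL ++ w.center :: w.outR := by
  rw [Word.sites, List.mem_toFinset]

theorem Word.walk_apply_of_notMem {w : Word} {σ : Config Λ} {j : Λ.sites}
    (hj : (j : ℤ) ∉ w.sites) : w.walk σ j = σ j :=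
  foldl_flip_apply_of_notMem σ (Word.mem_sites.not.mp hj)

end Flips

/-! ### Nonresonance near the origin and its probability -/

section GoodDisorder

/-- Changes of the spins at distance at most `N` from the origin are not resonant. -/
def IsGood (N : ℕ) (c : Couplings) (Λ : Box) : Prop :=
  ∀ σ τ : Config Λ, σ ≠ τ → (∀ i : Λ.sites, (N : ℤ) < |(i : ℤ)| → σ i = τ i) →
    4 * c.ε ≤ |energy c σ - energy c τ|

/-- The spin at `j` if the spins in `A` are `-1` and the others are `1`. -/
def signOf (A : Finset ℤ) (j : ℤ) : ℝ := if j ∈ A then -1 else 1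

/-- The coefficients of the couplings in the energy difference of two spin patterns. -/
def energyCoeff (A B : Finset ℤ) (p : Fin 3 × ℤ) : ℝ :=
  ![signOf A p.2 - signOf B p.2, 0,
    signOf A p.2 * signOf A (p.2 + 1) - signOf B p.2 * signOf B (p.2 + 1)] p.1

/-- The sites near the origin at which the spin is `-1`. -/
def minusSites (N : ℕ) {Λ : Box} (σ : Config Λ) : Finset ℤ :=
  (Finset.Icc (-(N : ℤ) - 2) (N + 2)).filter fun j => spin σ j = -1

theorem signOf_minusSites {N : ℕ} {Λ : Box} (σ : Config Λ) {j : ℤ}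
    (hj : j ∈ Finset.Icc (-(N : ℤ) - 2) (N + 2)) : signOf (minusSites N σ) j = spin σ j := by
  rcases spin_eq_one_or σ j with h | h
  · have : j ∉ minusSites N σ := by
      simp only [minusSites, Finset.mem_filter, h]
      norm_num
    rw [signOf, if_neg this, h]
  · have : j ∈ minusSites N σ := Finset.mem_filter.mpr ⟨hj, h⟩
    rw [signOf, if_pos this, h]

/-- Turns the energy difference into one of finitely many linear forms, chosen independently of the
box. The bonds that matter start at distance at most `N + 1`, so patterns must be recorded up to
distance `N + 2`. -/
theorem energy_sub_eq_sum {Ω : Type*} (V : RandomCouplings Ω) (γ : ℝ) (ω : Ω) {N : ℕ} {Λ : Box}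
    {σ τ : Config Λ} (h : ∀ i : Λ.sites, (N : ℤ) < |(i : ℤ)| → σ i = τ i) :
    energy (V.at γ ω) σ - energy (V.at γ ω) τ
      = ∑ p ∈ (Finset.univ : Finset (Fin 3)) ×ˢ Finset.Icc (-(N : ℤ) - 1) (N + 1),
        energyCoeff (minusSites N σ) (minusSites N τ) p * V.family p ω := by
  have hs : ∀ i : ℤ, (N : ℤ) < |i| → spin σ i = spin τ i := fun i hi =>
    spin_congr fun hm => h ⟨i, hm⟩ hi
  rw [energy_sub, Finset.sum_product, Fin.sum_univ_three]
  simp only [energyCoeff, RandomCouplings.family, Matrix.cons_val_zero, Matrix.cons_val_one,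
    Matrix.cons_val_two, Matrix.head_cons, Matrix.tail_cons, zero_mul, Finset.sum_const_zero,
    add_zero]
  congr 1
  -- The two ranges of summation differ only by vanishing terms: beyond the window the two
  -- configurations agree, and outside the box both are frozen to `1`.
  · refine Finset.sum_congr_of_eq_on_inter (fun i _ hi => ?_) (fun i hi hi' => ?_)
      (fun i _ hi => ?_)
    · rw [hs i, sub_self, mul_zero]
      rw [Finset.mem_Icc] at hi
      rw [lt_abs]
      omega
    · rw [Finset.mem_Icc] at hi
      rw [signOf_minusSites, signOf_minusSites, spin_of_notMem _ hi', spin_of_notMem _ hi',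
        sub_self, zero_mul] <;> (rw [Finset.mem_Icc]; omega)
    · rw [Finset.mem_Icc] at hi
      rw [signOf_minusSites, signOf_minusSites, mul_comm]
      · rfl
      all_goals (rw [Finset.mem_Icc]; omega)
  · refine Finset.sum_congr_of_eq_on_inter (fun i _ hi => ?_) (fun i hi hi' => ?_)
      (fun i _ hi => ?_)
    · rw [Finset.mem_Icc] at hi
      rw [hs i, hs (i + 1), sub_self, mul_zero] <;> (rw [lt_abs]; omega)
    · rw [Finset.mem_Icc] at hi hi'
      have h1 : i ∉ Λ.sites := by rw [Box.sites, Finset.mem_Icc]; omega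
      have h2 : i + 1 ∉ Λ.sites := by rw [Box.sites, Finset.mem_Icc]; omega
      rw [signOf_minusSites, signOf_minusSites, signOf_minusSites, signOf_minusSites,
        spin_of_notMem _ h1, spin_of_notMem _ h1, spin_of_notMem _ h2, spin_of_notMem _ h2,
        sub_self, zero_mul] <;> (rw [Finset.mem_Icc]; omega)
    · rw [Finset.mem_Icc] at hi
      rw [signOf_minusSites, signOf_minusSites, signOf_minusSites, signOf_minusSites, mul_comm]
      · rfl
      all_goals (rw [Finset.mem_Icc]; omega)

/-- The pairs of spin patterns within distance `N + 2` from the origin that differ at some site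
at distance at most `N`. -/
def patternPairs (N : ℕ) : Finset (Finset ℤ × Finset ℤ) :=
  ((Finset.Icc (-(N : ℤ) - 2) (N + 2)).powerset ×ˢ
    (Finset.Icc (-(N : ℤ) - 2) (N + 2)).powerset).filter fun A =>
      ((A.1 \ A.2 ∪ A.2 \ A.1) ∩ Finset.Icc (-(N : ℤ) - 1) (N + 1)).Nonempty

theorem exists_measurableSet_not_isGood (ρ₀ : ℝ) (N : ℕ) :
    ∃ B : ℝ, 0 ≤ B ∧ ∀ (Ω : Type*) [MeasurableSpace Ω] (μ : Measure Ω) [IsProbabilityMeasure μ]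
      (V : RandomCouplings Ω) (γ : ℝ) (Λ : Box), IsDisorder μ ρ₀ V → 0 ≤ γ →
      ∃ D : Set Ω, MeasurableSet D ∧ (∀ ω, ω ∉ D → IsGood N (V.at γ ω) Λ) ∧
        μ D ≤ ENNReal.ofReal (B * γ ^ (1 / 20 : ℝ)) := by
  refine ⟨(patternPairs N).card * (8 * |ρ₀|), by positivity, ?_⟩
  intro Ω _ μ _ V γ Λ hV hγ
  set S := (Finset.univ : Finset (Fin 3)) ×ˢ Finset.Icc (-(N : ℤ) - 1) (N + 1) with hS
  have hε : 0 ≤ γ ^ (1 / 20 : ℝ) := Real.rpow_nonneg hγ _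
  set D : Finset ℤ × Finset ℤ → Set Ω := fun A =>
    -- The events are indexed by patterns in the window rather than by configurations of the box;
    -- this makes the union finite, of bounded size, and measurable.
    {ω | |∑ p ∈ S, energyCoeff A.1 A.2 p * V.family p ω| < 4 * γ ^ (1 / 20 : ℝ)} with hD
  refine ⟨⋃ A ∈ patternPairs N, D A, ?_, ?_, ?_⟩
  · refine Finset.measurableSet_biUnion _ fun A _ => measurableSet_lt ?_ measurable_const
    exact (Finset.measurable_sum _ fun p _ => (hV.measurable p).const_mul _).abs
  · intro ω hω σ τ hne hagree
    by_contra hlt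
    rw [not_le] at hlt
    refine hω (Set.mem_biUnion (x := (minusSites N σ, minusSites N τ)) ?_ ?_)
    · obtain ⟨i, hi⟩ := Function.ne_iff.mp hne
      have hiN : |(i : ℤ)| ≤ N := not_lt.mp fun h => hi (hagree i h)
      have hspin : spin σ i ≠ spin τ i := fun h => hi (eq_of_spin_eq h)
      rw [abs_le] at hiN
      have hmem : (i : ℤ) ∈ Finset.Icc (-(N : ℤ) - 2) (N + 2) := by
        rw [Finset.mem_Icc]; omega
      refine Finset.mem_filter.mpr ⟨Finset.mk_mem_product
        (Finset.mem_powerset.mpr (Finset.filter_subset _ _))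
        (Finset.mem_powerset.mpr (Finset.filter_subset _ _)), i, Finset.mem_inter.mpr ⟨?_, ?_⟩⟩
      · simp only [minusSites, Finset.mem_union, Finset.mem_sdiff, Finset.mem_filter, hmem, true_and]
        rcases spin_eq_one_or σ i with h1 | h1 <;> rcases spin_eq_one_or τ i with h2 | h2
        · exact absurd (h1.trans h2.symm) hspin
        · right; rw [h1, h2]; norm_num
        · left; rw [h1, h2]; norm_num
        · exact absurd (h1.trans h2.symm) hspin
      · rw [Finset.mem_Icc]; omega
    · rw [energy_sub_eq_sum V γ ω hagree] at hlt
      exact hlt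
  · have hle : ∀ A ∈ patternPairs N,
        μ (D A) ≤ ENNReal.ofReal (2 * |ρ₀| * (4 * γ ^ (1 / 20 : ℝ))) := by
      intro A hA
      obtain ⟨j, hj⟩ := (Finset.mem_filter.mp hA).2
      rw [Finset.mem_inter, Finset.mem_union, Finset.mem_sdiff, Finset.mem_sdiff] at hj
      obtain ⟨hjA, hj⟩ := hj
      -- The distinguished variable is the field at a site `j` where the patterns differ; its
      -- coefficient is `±2`.
      refine hV.measure_abs_sum_lt_le S (energyCoeff A.1 A.2) (q := (0, j))
        (by simpa [hS] using hj) ?_ (by positivity)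
      rcases hjA with ⟨h1, h2⟩ | ⟨h1, h2⟩ <;>
        norm_num [energyCoeff, signOf, h1, h2]
    calc μ (⋃ A ∈ patternPairs N, D A) ≤ ∑ A ∈ patternPairs N, μ (D A) :=
          measure_biUnion_finset_le _ _
      _ ≤ (patternPairs N).card • ENNReal.ofReal (2 * |ρ₀| * (4 * γ ^ (1 / 20 : ℝ))) :=
          Finset.sum_le_card_nsmul _ _ _ hle
      _ = _ := by
          rw [← ENNReal.ofReal_nsmul, nsmul_eq_mul]
          congr 1
          ring

end GoodDisorder

end SpinChain
end

noncomputable section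

namespace SpinChain

/-! ### Combinatorics of ordered products -/

section Words

/-- There are at most two choices at each step, and at most one once a list is exhausted, so a
factorial is a crude bound. It suffices because the coefficient of a graph carries a compensating
inverse factorial. -/
theorem interleavings_le_factorial (v : Finset ℤ) (ls rs : List ℤ) :
    interleavings v ls rs ≤ (ls.length + rs.length).factorial := by
  fun_induction interleavings v ls rs with
  | case1 => simp
  | case2 v l ls _ ih1 => exact ih1.trans (Nat.factorial_le (by simp))
  | case3 => exact Nat.zero_le _
  | case4 v r rs _ ih1 => exact ih1.trans (Nat.factorial_le (by simp))
  | case5 => exact Nat.zero_le _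
  | case6 v l ls r rs ih1 ih2 =>
    simp only [List.length_cons] at ih1 ih2 ⊢
    have h : (ls.length + 1 + (rs.length + 1)).factorial
        = (ls.length + rs.length + 2) * (ls.length + rs.length + 1).factorial := by
      rw [← Nat.factorial_succ]
      congr 1
      omega
    rw [h]
    rw [← add_assoc] at ih1
    rw [add_right_comm] at ih2
    have h2 : (ls.length + rs.length + 2) * (ls.length + rs.length + 1).factorial
        = (ls.length + rs.length + 1).factorial + (ls.length + rs.length + 1).factorial
          + (ls.length + rs.length) * (ls.length + rs.length + 1).factorial := by ring
    split_ifs <;> omega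

theorem interleavings_comm (v : Finset ℤ) (ls rs : List ℤ) :
    interleavings v ls rs = interleavings v rs ls := by
  fun_induction interleavings v ls rs with
  | case1 => rw [interleavings]
  | case2 v l ls h ih1 => rw [interleavings, if_pos h, ih1]
  | case3 v l ls h => rw [interleavings, if_neg h]
  | case4 v r rs h ih1 => rw [interleavings, if_pos h, ih1]
  | case5 v r rs h => rw [interleavings, if_neg h]
  | case6 v l ls r rs ih1 ih2 =>
    conv_rhs => rw [interleavings]
    rw [ih1, ih2, add_comm]

/-- Each admissible step reaches at most one site beyond the visited set, so `n` steps extend its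
radius around `z` by at most `n`. -/
theorem abs_sub_le_of_interleavings_ne_zero (v : Finset ℤ) (ls rs : List ℤ) (z : ℤ) (k : ℕ)
    (hv : ∀ x ∈ v, |x - z| ≤ k) (h : interleavings v ls rs ≠ 0) :
    ∀ x ∈ ls ++ rs, |x - z| ≤ (k + ls.length + rs.length : ℕ) := by
  have hins : ∀ (v : Finset ℤ) (l : ℤ) (k : ℕ), (∀ x ∈ v, |x - z| ≤ k) →
      (∃ x ∈ v, |l - x| ≤ 1) → ∀ x ∈ insert l v, |x - z| ≤ (k + 1 : ℕ) := by
    intro v l k hv hl x hx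
    rcases Finset.mem_insert.mp hx with rfl | hx
    · obtain ⟨y, hy, hxy⟩ := hl
      have := abs_sub_le x y z
      have := hv y hy
      push_cast
      omega
    · have := hv x hx
      push_cast
      omega
  fun_induction interleavings v ls rs generalizing k with
  | case1 => simp
  | case2 v l ls hl ih1 =>
    have h1 := ih1 (k + 1) (hins v l k hv hl) h
    have h0 := hins v l k hv hl l (Finset.mem_insert_self _ _)
    simp only [List.append_nil, List.mem_cons, List.length_cons, List.length_nil] at h1 ⊢
    rintro x (rfl | hx)
    · push_cast at h0 ⊢; omega
    · have := h1 x hx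
      push_cast at this ⊢; omega
  | case3 => exact absurd rfl h
  | case4 v r rs hl ih1 =>
    have h1 := ih1 (k + 1) (hins v r k hv hl) h
    have h0 := hins v r k hv hl r (Finset.mem_insert_self _ _)
    simp only [List.nil_append, List.mem_cons, List.length_cons, List.length_nil] at h1 ⊢
    rintro x (rfl | hx)
    · push_cast at h0 ⊢; omega
    · have := h1 x hx
      push_cast at this ⊢; omega
  | case5 => exact absurd rfl h
  | case6 v l ls r rs ih1 ih2 =>
    simp only [List.mem_append, List.mem_cons, List.length_cons] at ih1 ih2 ⊢
    have hor : (∃ x ∈ v, |l - x| ≤ 1) ∧ interleavings (insert l v) ls (r :: rs) ≠ 0 ∨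
        (∃ x ∈ v, |r - x| ≤ 1) ∧ interleavings (insert r v) (l :: ls) rs ≠ 0 := by
      by_contra hcon
      rw [not_or] at hcon
      apply h
      rw [Nat.add_eq_zero_iff]
      constructor
      · split_ifs with hl
        · by_contra hne
          exact hcon.1 ⟨hl, hne⟩
        · rfl
      · split_ifs with hl
        · by_contra hne
          exact hcon.2 ⟨hl, hne⟩
        · rfl
    rcases hor with ⟨hl, hne⟩ | ⟨hl, hne⟩
    · have h1 := ih1 (k + 1) (hins v l k hv hl) hne
      have h0 := hins v l k hv hl l (Finset.mem_insert_self _ _)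
      intro x hx
      by_cases hxl : x = l
      · subst hxl
        push_cast at h0 ⊢; omega
      · have := h1 x (by tauto)
        push_cast at this ⊢; omega
    · have h1 := ih2 (k + 1) (hins v r k hv hl) hne
      have h0 := hins v r k hv hl r (Finset.mem_insert_self _ _)
      intro x hx
      by_cases hxl : x = r
      · subst hxl
        push_cast at h0 ⊢; omega
      · have := h1 x (by tauto)
        push_cast at this ⊢; omega

theorem Word.abs_sub_center_le {w : Word} (hw : w.multiplicity ≠ 0) {x : ℤ} (hx : x ∈ w.sites) :
    |x - w.center| ≤ w.order := by
  have h := abs_sub_le_of_interleavings_ne_zero {w.center} w.outL w.outR w.center 0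
    (by simp) hw x
  simp only [Word.mem_sites, List.mem_append, List.mem_cons] at hx
  simp only [List.mem_append, zero_add] at h
  rcases hx with hx | rfl | hx
  · exact h (Or.inl hx)
  · simp
  · exact h (Or.inr hx)

theorem Word.abs_sub_le {w : Word} (hw : w.multiplicity ≠ 0) {x y : ℤ} (hx : x ∈ w.sites)
    (hy : y ∈ w.sites) : |x - y| ≤ 2 * w.order := by
  have h1 := Word.abs_sub_center_le hw hx
  have h2 := Word.abs_sub_center_le hw hy
  rw [abs_le] at *
  omega

/-- The reversed ordered product. -/
def Word.reverse (w : Word) : Word := ⟨w.outR, w.center, w.outL⟩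

theorem Word.reverse_reverse (w : Word) : w.reverse.reverse = w := rfl

theorem Word.order_reverse (w : Word) : w.reverse.order = w.order := Nat.add_comm _ _

theorem Word.length_reverse (w : Word) : w.reverse.length = w.length :=
  congrArg (· + 1) w.order_reverse

theorem Word.sites_reverse (w : Word) : w.reverse.sites = w.sites := by
  ext i
  simp only [Word.mem_sites, Word.reverse, List.mem_append, List.mem_cons]
  tauto

theorem Word.multiplicity_reverse (w : Word) : w.reverse.multiplicity = w.multiplicity :=
  interleavings_comm _ _ _

theorem isGraph_reverse {c : Couplings} {Λ : Box} {w : Word} :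
    IsGraph c Λ w.reverse ↔ IsGraph c Λ w := by
  have h : (∀ i ∈ w.reverse.outL ++ w.reverse.outR, i ∉ S1 c Λ) ↔
      ∀ i ∈ w.outL ++ w.outR, i ∉ S1 c Λ := by
    simp only [Word.reverse, List.mem_append]
    exact forall_congr' fun i => imp_congr or_comm Iff.rfl
  rw [IsGraph, h, Word.sites_reverse, Word.multiplicity_reverse, Word.order_reverse]
  rfl

theorem isExternal_reverse {c : Couplings} {Λ : Box} {w : Word} :
    IsExternal c Λ w.reverse ↔ IsExternal c Λ w := by
  rw [IsExternal, isGraph_reverse, Word.sites_reverse, IsExternal]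

open Classical in
/-- The words with at most two generators and with all sites in `X`. -/
def shortWords (X : Finset ℤ) : Finset Word :=
  let L : Finset (List ℤ) := {[]} ∪ X.image (fun a => [a]) ∪ (X ×ˢ X).image fun q => [q.1, q.2]
  (L ×ˢ X ×ˢ L).image fun q => ⟨q.1, q.2.1, q.2.2⟩

theorem mem_shortWords {X : Finset ℤ} {w : Word} (hw : w.order ≤ 2) (hX : w.sites ⊆ X) :
    w ∈ shortWords X := by
  have hX' : ∀ i ∈ w.outL ++ w.center :: w.outR, i ∈ X := fun i hi => hX (Word.mem_sites.mpr hi)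
  have hL : ∀ l : List ℤ, l.length ≤ 2 → (∀ i ∈ l, i ∈ X) →
      l ∈ ({[]} ∪ X.image (fun a => [a]) ∪ (X ×ˢ X).image fun q => [q.1, q.2] :
        Finset (List ℤ)) := by
    intro l hl hlX
    match l, hl, hlX with
    | [], _, _ => simp
    | [a], _, h => simpa using h
    | [a, b], _, h => simpa using h
    | _ :: _ :: _ :: _, h, _ => exact absurd h (by simp)
  simp only [Word.order] at hw
  simp only [List.mem_append, List.mem_cons] at hX'
  simp only [shortWords, Finset.mem_image]
  refine ⟨(w.outL, w.center, w.outR), ?_, rfl⟩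
  refine Finset.mk_mem_product (hL _ (by omega) fun i hi => hX' i (Or.inl hi)) ?_
  exact Finset.mk_mem_product (hX' _ (Or.inr (Or.inl rfl)))
    (hL _ (by omega) fun i hi => hX' i (Or.inr (Or.inr hi)))

end Words

/-! ### Symmetry and size of the graph terms -/

section GraphTerms

variable {Λ : Box}

theorem transpose_A1 (c : Couplings) (i : ℤ) : (A1 c Λ i)ᵀ = -A1 c Λ i := by
  ext σ τ
  have h : σ = flip τ i ↔ τ = flip σ i := by
    constructor <;> · rintro rfl; exact (flip_flip _ i).symm
  rw [Matrix.transpose_apply, Matrix.neg_apply, A1, A1]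
  by_cases hτ : τ = flip σ i
  · rw [if_pos (h.mpr hτ), if_pos hτ, ← neg_sub, div_neg]
  · rw [if_neg (h.not.mpr hτ), if_neg hτ, neg_zero]

theorem transpose_prod_A1 (c : Couplings) (l : List ℤ) :
    ((l.map (A1 c Λ)).prod)ᵀ = ((-1 : ℝ) ^ l.length) • (l.reverse.map (A1 c Λ)).prod := by
  induction l with
  | nil => simp
  | cons i l ih =>
    rw [List.map_cons, List.prod_cons, Matrix.transpose_mul, ih, transpose_A1, List.reverse_cons,
      List.map_append, List.prod_append, List.length_cons, pow_succ]
    simp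

theorem transpose_J0 (c : Couplings) (i : ℤ) : (J0 c Λ i)ᵀ = J0 c Λ i := by
  rw [J0, Matrix.transpose_smul]
  congr 1
  have := Sx_isHermitian Λ i
  rwa [Matrix.IsHermitian, Matrix.conjTranspose_eq_transpose_of_trivial] at this

/-- Transposition reverses the product, and each antisymmetric factor `A(i)` gives a sign. The total
sign `(-1)^n` is what turns the coefficient sign `(-1)^|outR|` into `(-1)^|outL|`. -/
theorem transpose_graphTerm (c : Couplings) (w : Word) :
    (graphTerm c Λ w)ᵀ = graphTerm c Λ w.reverse := by
  have hsq : ∀ n : ℕ, ((-1 : ℝ) ^ n) * (-1) ^ n = 1 := fun n => by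
    rw [← mul_pow]
    norm_num
  have hL := transpose_prod_A1 (Λ := Λ) c w.outL.reverse
  rw [List.reverse_reverse, List.length_reverse] at hL
  have hrev : graphTerm c Λ w.reverse = ((w.multiplicity : ℝ) * (-1) ^ w.outL.length *
      (if w.center ∈ S1 c Λ then 1 / (w.order.factorial : ℝ)
        else (w.order : ℝ) / ((w.order + 1).factorial : ℝ))) •
      ((w.outR.reverse.map (A1 c Λ)).prod * J0 c Λ w.center * (w.outL.map (A1 c Λ)).prod) := by
    rw [graphTerm, Word.multiplicity_reverse, Word.order_reverse]
    rfl
  rw [hrev, graphTerm, Matrix.transpose_smul, Matrix.transpose_mul, Matrix.transpose_mul, hL,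
    transpose_J0, transpose_prod_A1]
  simp only [Matrix.smul_mul, Matrix.mul_smul, smul_smul, Matrix.mul_assoc]
  congr 1
  linear_combination (w.multiplicity : ℝ) * (if w.center ∈ S1 c Λ
    then 1 / (w.order.factorial : ℝ) else (w.order : ℝ) / ((w.order + 1).factorial : ℝ))
      * (-1) ^ w.outL.length * hsq w.outR.length

theorem mem_S1 {c : Couplings} {i : ℤ} :
    i ∈ S1 c Λ ↔ i ∈ Λ.sites ∧ IsResonantSite c Λ i := by
  simp only [S1, Finset.mem_filter]

theorem isMonomial_A1 {c : Couplings} (hγ : 0 ≤ c.γ) (hε : 0 < c.ε) (hΓ : ∀ i, |c.Γ i| ≤ 1)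
    {i : ℤ} (hi : i ∈ Λ.sites) (hS : i ∉ S1 c Λ) :
    IsMonomial (fun σ => flip σ i) (c.γ / c.ε) (A1 c Λ i) := by
  intro σ τ
  rw [A1]
  split_ifs with hτ
  · refine ⟨?_, fun _ => hτ⟩
    have hres : c.ε ≤ |energy c σ - energy c τ| := by
      by_contra h
      exact hS (mem_S1.mpr ⟨hi, σ, by rw [← hτ]; exact not_le.mp h⟩)
    rw [abs_div, abs_mul, abs_of_nonneg hγ]
    exact div_le_div₀ hγ (mul_le_of_le_one_right hγ (hΓ i)) hε hres
  · simp only [abs_zero, ne_eq, not_true_eq_false, false_implies, and_true]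
    positivity

theorem isMonomial_prod_A1 {c : Couplings} (hγ : 0 ≤ c.γ) (hε : 0 < c.ε)
    (hΓ : ∀ i, |c.Γ i| ≤ 1) {l : List ℤ} (hl : ∀ i ∈ l, i ∈ Λ.sites ∧ i ∉ S1 c Λ) :
    IsMonomial (fun σ => l.foldl flip σ) ((c.γ / c.ε) ^ l.length) (l.map (A1 c Λ)).prod := by
  induction l with
  | nil => exact isMonomial_one
  | cons i l ih =>
    rw [List.map_cons, List.prod_cons, List.length_cons, pow_succ']
    exact (isMonomial_A1 hγ hε hΓ (hl i (by simp)).1 (hl i (by simp)).2).mul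
      (ih fun j hj => hl j (by simp [hj]))

theorem isMonomial_J0 {c : Couplings} (hγ : 0 ≤ c.γ) (hΓ : ∀ i, |c.Γ i| ≤ 1) (i : ℤ) :
    IsMonomial (fun σ => flip σ i) c.γ (J0 c Λ i) := by
  intro σ τ
  rw [J0, Matrix.smul_apply, Sx, smul_eq_mul]
  split_ifs with hτ
  · rw [mul_one, abs_mul, abs_of_nonneg hγ]
    exact ⟨mul_le_of_le_one_right hγ (hΓ i), fun _ => hτ⟩
  · simpa using hγ

/-- The multiplicity is at most `n!`, while both kinds of coefficients are at most `1/n!`, since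
`n/(n+1)! ≤ 1/n!`. -/
theorem abs_graphCoeff_le (w : Word) (p : Prop) [Decidable p] :
    |(w.multiplicity : ℝ) * (-1) ^ w.outR.length *
      (if p then 1 / (w.order.factorial : ℝ)
        else (w.order : ℝ) / ((w.order + 1).factorial : ℝ))| ≤ 1 := by
  have hm : (w.multiplicity : ℝ) ≤ w.order.factorial := by
    exact_mod_cast interleavings_le_factorial {w.center} w.outL w.outR
  have hpos : (0 : ℝ) < w.order.factorial := by positivity
  have hle : (if p then 1 / (w.order.factorial : ℝ)
      else (w.order : ℝ) / ((w.order + 1).factorial : ℝ)) ≤ 1 / w.order.factorial := by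
    split_ifs
    · exact le_rfl
    · rw [Nat.factorial_succ, div_le_div_iff₀ (by positivity) hpos]
      push_cast
      nlinarith
  have h0 : 0 ≤ (if p then 1 / (w.order.factorial : ℝ)
      else (w.order : ℝ) / ((w.order + 1).factorial : ℝ)) := by
    split_ifs <;> positivity
  rw [abs_mul, abs_mul, abs_pow, abs_neg, abs_one, one_pow, mul_one, abs_of_nonneg h0,
    Nat.abs_cast]
  calc (w.multiplicity : ℝ) * _ ≤ w.order.factorial * (1 / w.order.factorial) :=
        mul_le_mul hm hle h0 hpos.le
    _ = 1 := mul_one_div_cancel hpos.ne'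

theorem isMonomial_graphTerm {c : Couplings} (hγ : 0 ≤ c.γ) (hε : 0 < c.ε)
    (hΓ : ∀ i, |c.Γ i| ≤ 1) {w : Word} (hw : IsGraph c Λ w) :
    IsMonomial w.walk (c.γ * (c.γ / c.ε) ^ w.order) (graphTerm c Λ w) := by
  have hmem : ∀ i ∈ w.outL ++ w.outR, i ∈ Λ.sites ∧ i ∉ S1 c Λ := by
    intro i hi
    refine ⟨hw.1 (Word.mem_sites.mpr ?_), hw.2.1 i hi⟩
    simp only [List.mem_append, List.mem_cons] at hi ⊢
    tauto
  have hL := isMonomial_prod_A1 (Λ := Λ) hγ hε hΓ (l := w.outL.reverse)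
    fun i hi => hmem i (by simp at hi; simp [hi])
  have hR := isMonomial_prod_A1 (Λ := Λ) hγ hε hΓ (l := w.outR)
    fun i hi => hmem i (by simp [hi])
  have h := ((hL.mul (isMonomial_J0 hγ hΓ w.center)).mul hR).smul
    ((w.multiplicity : ℝ) * (-1) ^ w.outR.length *
      (if w.center ∈ S1 c Λ then 1 / (w.order.factorial : ℝ)
        else (w.order : ℝ) / ((w.order + 1).factorial : ℝ)))
  have hnn : 0 ≤ c.γ * (c.γ / c.ε) ^ w.order := by positivity
  intro σ τ
  refine ⟨(h σ τ).1.trans ?_, fun hne => ((h σ τ).2 hne).trans ?_⟩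
  · refine le_trans (le_of_eq ?_)
      (mul_le_of_le_one_left hnn (abs_graphCoeff_le w (w.center ∈ S1 c Λ)))
    rw [List.length_reverse, Word.order, pow_add]
    ring
  -- The left factors appear in reverse order in the product, which does not matter because flips
  -- commute.
  · change w.outR.foldl flip (flip (w.outL.reverse.foldl flip σ) w.center) = _
    rw [foldl_flip_perm w.outL.reverse_perm, Word.walk, List.foldl_append, List.foldl_cons]

end GraphTerms

end SpinChain
end

noncomputable section

namespace SpinChain

/-! ### Locality: supports and invariance under distant flips -/

section Locality

variable {Λ : Box}

/-- The matrix `M` changes only the spins in `X`. -/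
def ActsOn (X : Finset ℤ) (M : Op Λ) : Prop :=
  ∀ σ τ, M σ τ ≠ 0 → ∀ i : Λ.sites, (i : ℤ) ∉ X → σ i = τ i

theorem ActsOn.mono {X Y : Finset ℤ} {M : Op Λ} (hM : ActsOn X M) (h : X ⊆ Y) : ActsOn Y M :=
  fun σ τ hne i hi => hM σ τ hne i fun hX => hi (h hX)

theorem actsOn_one (X : Finset ℤ) : ActsOn X (1 : Op Λ) := by
  intro σ τ hne i _
  rw [Matrix.one_apply, ne_eq, ite_eq_right_iff, Classical.not_imp] at hne
  rw [hne.1]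

theorem ActsOn.mul {X : Finset ℤ} {M N : Op Λ} (hM : ActsOn X M) (hN : ActsOn X N) :
    ActsOn X (M * N) := by
  intro σ τ hne i hi
  rw [Matrix.mul_apply] at hne
  obtain ⟨ρ, -, hρ⟩ := Finset.exists_ne_zero_of_sum_ne_zero hne
  exact (hM σ ρ (left_ne_zero_of_mul hρ) i hi).trans (hN ρ τ (right_ne_zero_of_mul hρ) i hi)

theorem ActsOn.transpose {X : Finset ℤ} {M : Op Λ} (hM : ActsOn X M) : ActsOn X Mᵀ :=
  fun σ τ hne i hi => (hM τ σ hne i hi).symm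

theorem ActsOn.commute_Sz {X : Finset ℤ} {M : Op Λ} (hM : ActsOn X M) {i : ℤ} (hi : i ∉ X) :
    M * Sz Λ i = Sz Λ i * M := by
  ext σ τ
  rw [Sz, Matrix.mul_diagonal, Matrix.diagonal_mul]
  by_cases hne : M σ τ = 0
  · rw [hne, zero_mul, mul_zero]
  · rw [spin_congr fun hm => hM σ τ hne ⟨i, hm⟩ hi, mul_comm]

/-- The factors come in an arbitrary enumeration of the blocks. Properties closed under products do
not depend on it, so commutation of the block rotations is never needed. -/
theorem blockProduct_induction {B : Finset (Finset ℤ)} {U : Finset ℤ → Op Λ} (p : Op Λ → Prop)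
    (one : p 1) (mul : ∀ M N, p M → p N → p (M * N)) (h : ∀ b ∈ B, p (U b)) :
    p (blockProduct B U) := by
  refine List.prod_induction p mul one fun M hM => ?_
  obtain ⟨b, hb, rfl⟩ := List.mem_map.mp hM
  exact h b (Finset.mem_toList.mp hb)

/-- The matrix `M` commutes with the flips at the sites of `l`. -/
def FlipInvariant (l : List ℤ) (M : Op Λ) : Prop :=
  ∀ σ τ, M (l.foldl flip σ) (l.foldl flip τ) = M σ τ

theorem flipInvariant_one (l : List ℤ) : FlipInvariant l (1 : Op Λ) := by
  intro σ τ
  simp only [Matrix.one_apply, (foldl_flip_involutive l).injective.eq_iff]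

theorem FlipInvariant.mul {l : List ℤ} {M N : Op Λ} (hM : FlipInvariant l M)
    (hN : FlipInvariant l N) : FlipInvariant l (M * N) := by
  intro σ τ
  rw [Matrix.mul_apply, Matrix.mul_apply, ← Equiv.sum_comp (flipPerm Λ l)]
  exact Finset.sum_congr rfl fun ρ _ => by rw [flipPerm_apply, hM, hN]

theorem FlipInvariant.transpose {l : List ℤ} {M : Op Λ} (hM : FlipInvariant l M) :
    FlipInvariant l Mᵀ :=
  fun σ τ => hM τ σ

theorem FlipInvariant.smul {l : List ℤ} {M : Op Λ} (hM : FlipInvariant l M) (r : ℝ) :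
    FlipInvariant l (r • M) :=
  fun σ τ => by rw [Matrix.smul_apply, Matrix.smul_apply, hM]

theorem FlipInvariant.sum {ι : Type*} {l : List ℤ} {s : Finset ι} {M : ι → Op Λ}
    (hM : ∀ i ∈ s, FlipInvariant l (M i)) : FlipInvariant l (∑ i ∈ s, M i) := by
  intro σ τ
  rw [Matrix.sum_apply, Matrix.sum_apply]
  exact Finset.sum_congr rfl fun i hi => hM i hi σ τ

/-- A divergent series has the value `0`, which is invariant too, so convergence of the graph
expansion need not be known. -/
theorem FlipInvariant.tsum {ι : Type*} {l : List ℤ} {M : ι → Op Λ}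
    (hM : ∀ i, FlipInvariant l (M i)) : FlipInvariant l (∑' i, M i) := by
  intro σ τ
  by_cases hs : Summable M
  · have h : ∀ α β, HasSum (fun i => M i α β) ((∑' i, M i) α β) := fun α β =>
      Pi.hasSum.mp (Pi.hasSum.mp hs.hasSum α) β
    have h1 := h (l.foldl flip σ) (l.foldl flip τ)
    simp only [hM _ σ τ] at h1
    exact h1.unique (h σ τ)
  · rw [tsum_eq_zero_of_not_summable hs]
    rfl

theorem flip_foldl_flip (l : List ℤ) (σ : Config Λ) (i : ℤ) :
    flip (l.foldl flip σ) i = l.foldl flip (flip σ i) :=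
  foldl_flip_comm [i] l σ

theorem flipInvariant_Sx (l : List ℤ) (i : ℤ) : FlipInvariant l (Sx Λ i) := by
  intro σ τ
  simp only [Sx, flip_foldl_flip, (foldl_flip_involutive l).injective.eq_iff]

theorem flip_apply_of_ne (σ : Config Λ) {i : ℤ} {j : Λ.sites} (h : (j : ℤ) ≠ i) :
    flip σ i j = σ j := by
  simp [flip, h]

/-- The energy denominator involves only the spins at `i` and its neighbours. -/
theorem flipInvariant_A1 (c : Couplings) {l : List ℤ} {i : ℤ} (h : ∀ k ∈ l, 1 < |i - k|) :
    FlipInvariant l (A1 c Λ i) := by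
  intro σ τ
  simp only [A1, flip_foldl_flip, (foldl_flip_involutive l).injective.eq_iff]
  split_ifs with hτ
  · subst hτ
    have hfar : ∀ j : Λ.sites, |(j : ℤ) - i| ≤ 1 → (j : ℤ) ∉ l := fun j hj hjl => by
      have := h j hjl
      rw [abs_sub_comm] at this
      omega
    rw [energy_sub_congr c {i} (σ' := σ) (τ' := flip σ i)]
    · intro j hj
      rw [foldl_flip_congr, flip_apply_of_ne _ hj]
    · intro j hj
      rw [flip_apply_of_ne _ hj]
    · rintro j ⟨k, rfl, hk⟩
      exact ⟨foldl_flip_apply_of_notMem _ (hfar j hk), foldl_flip_apply_of_notMem _ (hfar j hk)⟩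
  · rfl

theorem flipInvariant_prod_A1 (c : Couplings) {l s : List ℤ}
    (h : ∀ i ∈ s, ∀ k ∈ l, 1 < |i - k|) : FlipInvariant l (s.map (A1 c Λ)).prod := by
  refine List.prod_induction _ (fun _ _ => FlipInvariant.mul) (flipInvariant_one l) ?_
  intro M hM
  obtain ⟨i, hi, rfl⟩ := List.mem_map.mp hM
  exact flipInvariant_A1 c (h i hi)

theorem flipInvariant_graphTerm (c : Couplings) {l : List ℤ} {w : Word}
    (h : ∀ i ∈ w.sites, ∀ k ∈ l, 1 < |i - k|) : FlipInvariant l (graphTerm c Λ w) := by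
  refine FlipInvariant.smul (FlipInvariant.mul (FlipInvariant.mul ?_ ?_) ?_) _
  · exact flipInvariant_prod_A1 c fun i hi => h i (Word.mem_sites.mpr (by simp_all))
  · exact (flipInvariant_Sx l _).smul _
  · exact flipInvariant_prod_A1 c fun i hi => h i (Word.mem_sites.mpr (by simp_all))

theorem mem_collar {k : ℕ} {X : Finset ℤ} {x : ℤ} :
    x ∈ collar Λ k X ↔ x ∈ Λ.sites ∧ ∃ y ∈ X, |x - y| ≤ (k : ℤ) := by
  simp only [collar, Finset.mem_filter]

theorem bar1_subset_barbar1 (b : Finset ℤ) : bar1 Λ b ⊆ barbar1 Λ b := fun x hx =>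
  mem_collar.mpr ⟨(mem_collar.mp hx).1, x, hx, by simp⟩

theorem flipInvariant_J1sint (c : Couplings) {l : List ℤ} {b : Finset ℤ}
    (h : ∀ x ∈ barbar1 Λ b, ∀ k ∈ l, 1 < |x - k|) : FlipInvariant l (J1sint c Λ b) := by
  refine FlipInvariant.tsum fun w => ?_
  split_ifs with hw
  · exact flipInvariant_graphTerm c fun i hi => h i (bar1_subset_barbar1 b (hw.2.2 hi))
  · exact fun _ _ => rfl

/-- If the two configurations agree off `X`, the entry depends only on the spins in `Y`, which are
not flipped. Otherwise both entries vanish, because flips preserve disagreement at each site. -/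
theorem IsBlockRotation.flipInvariant {X Y : Finset ℤ} {M U : Op Λ}
    (hU : IsBlockRotation X Y M U) {l : List ℤ} (h : ∀ x ∈ Y, x ∉ l) : FlipInvariant l U := by
  intro σ τ
  have hfix : ∀ (ρ : Config Λ) (i : Λ.sites), (i : ℤ) ∈ Y → l.foldl flip ρ i = ρ i :=
    fun ρ i hi => foldl_flip_apply_of_notMem ρ (h i hi)
  by_cases hX : ∀ i : Λ.sites, (i : ℤ) ∉ X → σ i = τ i
  · exact hU.depends _ _ _ _ (fun i hi => ⟨hfix σ i hi, hfix τ i hi⟩)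
      (fun i hi => (foldl_flip_congr l).mpr (hX i hi)) hX
  · have h1 : U σ τ = 0 := by
      by_contra hne
      exact hX (hU.acts σ τ hne)
    have h2 : U (l.foldl flip σ) (l.foldl flip τ) = 0 := by
      by_contra hne
      exact hX fun i hi => (foldl_flip_congr l).mp (hU.acts _ _ hne i hi)
    rw [h1, h2]

end Locality

/-! ### Block energies under distant flips -/

section BlockEnergies

variable {Λ : Box} {m₀ : ℕ} {c : Couplings} {U : Finset ℤ → Op Λ}

theorem IsStep1Rotation.blockProduct_orthogonal (hU : IsStep1Rotation m₀ c Λ U)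
    {B : Finset (Finset ℤ)} (hB : B ⊆ small1 m₀ c Λ) :
    (blockProduct B U)ᵀ * blockProduct B U = 1 :=
  blockProduct_induction (fun M => Mᵀ * M = 1) (by simp) (fun _ _ => transpose_mul_mul)
    fun b hb => (hU b (hB hb)).orthogonal

theorem IsStep1Rotation.blockProduct_actsOn (hU : IsStep1Rotation m₀ c Λ U)
    {B : Finset (Finset ℤ)} (hB : B ⊆ small1 m₀ c Λ) :
    ActsOn (B.biUnion (bar1 Λ)) (blockProduct B U) :=
  blockProduct_induction (ActsOn _) (actsOn_one _) (fun _ _ => ActsOn.mul)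
    fun b hb => ActsOn.mono (hU b (hB hb)).acts (Finset.subset_biUnion_of_mem _ hb)

/-- Flips far away from the small blocks change the block energies by the same amount as the
energies of the Hamiltonian. -/
theorem energy1_sub (hU : IsStep1Rotation m₀ c Λ U) {l : List ℤ}
    (hl : ∀ b ∈ small1 m₀ c Λ, ∀ x ∈ barbar1 Λ b, ∀ k ∈ l, 1 < |x - k|) (σ : Config Λ) :
    energy1 m₀ c Λ U σ - energy1 m₀ c Λ U (l.foldl flip σ)
      = energy c σ - energy c (l.foldl flip σ) := by
  set O := O1 m₀ c Λ U with hO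
  have hOo : Oᵀ * O = 1 := hU.blockProduct_orthogonal subset_rfl
  have hOa : ActsOn ((small1 m₀ c Λ).biUnion (bar1 Λ)) O := hU.blockProduct_actsOn subset_rfl
  have hnot : ∀ b ∈ small1 m₀ c Λ, ∀ x ∈ barbar1 Λ b, x ∉ l := fun b hb x hx hxl => by
    have := hl b hb x hx x hxl
    simp at this
  have hOf : FlipInvariant l O :=
    blockProduct_induction (FlipInvariant l) (flipInvariant_one l) (fun _ _ => FlipInvariant.mul)
      fun b hb => (hU b hb).flipInvariant (hnot b hb)
  have hJf : FlipInvariant l (∑ b ∈ small1 m₀ c Λ, J1sint c Λ b) :=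
    FlipInvariant.sum fun b hb => flipInvariant_J1sint c (hl b hb)
  have hdiag : ∀ ρ : Config Λ, (Oᵀ * Matrix.diagonal (energy c) * O : Op Λ) ρ ρ
      = ∑ τ, O τ ρ ^ 2 * energy c τ := by
    intro ρ
    rw [Matrix.mul_apply]
    refine Finset.sum_congr rfl fun τ _ => ?_
    rw [Matrix.mul_diagonal, Matrix.transpose_apply]
    ring
  have hE : ∀ ρ, energy1 m₀ c Λ U ρ = ∑ τ, O τ ρ ^ 2 * energy c τ
      + (Oᵀ * (∑ b ∈ small1 m₀ c Λ, J1sint c Λ b) * O : Op Λ) ρ ρ := by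
    intro ρ
    rw [energy1, ← hO, mul_add, add_mul, Matrix.add_apply, hdiag]
  -- The squares of a column of `O` are weights of sum one. The `H₀` part of the block energy is
  -- thus an average of energies, and the claim reduces to each `τ` of nonzero weight.
  have hcol : ∑ τ, O τ σ ^ 2 = 1 := by
    have h := congrFun (congrFun hOo σ) σ
    rw [Matrix.mul_apply, Matrix.one_apply_eq] at h
    rw [← h]
    exact Finset.sum_congr rfl fun τ _ => by rw [Matrix.transpose_apply, sq]
  rw [hE, hE, (hOf.transpose.mul hJf).mul hOf σ σ, add_sub_add_right_eq_sub,
    ← Equiv.sum_comp (flipPerm Λ l) fun τ => O τ (l.foldl flip σ) ^ 2 * energy c τ,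
    ← Finset.sum_sub_distrib, ← one_mul (energy c σ - _), ← hcol, Finset.sum_mul]
  refine Finset.sum_congr rfl fun τ _ => ?_
  rw [flipPerm_apply, hOf, ← mul_sub]
  by_cases hne : O τ σ = 0
  · rw [hne]
    ring
  · congr 1
    -- A configuration `τ` of nonzero weight differs from `σ` only inside the collared blocks, away
    -- from the flips and their neighbours, so the flips cost the same in both.
    have hagree : ∀ i : Λ.sites, (∃ k ∈ {k | k ∈ l}, |(i : ℤ) - k| ≤ 1) → τ i = σ i := by
      rintro i ⟨k, hk, hik⟩
      refine hOa τ σ hne i fun hi => ?_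
      obtain ⟨b, hb, hib⟩ := Finset.mem_biUnion.mp hi
      have := hl b hb i (bar1_subset_barbar1 b hib) k hk
      omega
    refine energy_sub_congr c {k | k ∈ l} (fun i hi => ?_) (fun i hi => ?_) fun i hi => ?_
    · exact (foldl_flip_apply_of_notMem τ hi).symm
    · exact (foldl_flip_apply_of_notMem σ hi).symm
    · exact ⟨hagree i hi, (foldl_flip_congr l).mpr (hagree i hi)⟩

end BlockEnergies

end SpinChain
end

noncomputable section

namespace SpinChain

open scoped Matrix.Norms.L2Operator

/-! ### Absence of blocks near the origin for good disorder -/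

section NearOrigin

variable {Λ : Box} {m₀ : ℕ} {c : Couplings} {U : Finset ℤ → Op Λ}

theorem subset_of_mem_components {d : ℝ} {T X : Finset ℤ} (h : X ∈ components d T) : X ⊆ T := by
  classical
  simp only [components, Finset.mem_image] at h
  obtain ⟨x, -, rfl⟩ := h
  exact Finset.filter_subset _ _

theorem subset_S1_of_mem_small1 {b : Finset ℤ} (hb : b ∈ small1 m₀ c Λ) : b ⊆ S1 c Λ := by
  simp only [small1, Finset.mem_filter] at hb
  exact subset_of_mem_components hb.1

theorem remaining_subset (m : ℕ) : remaining m₀ c Λ U m ⊆ S1 c Λ ∪ resonant2 m₀ c Λ U := by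
  induction m with
  | zero => exact subset_rfl
  | succ m ih => exact Finset.sdiff_subset.trans ih

theorem subset_of_mem_small2 {b : Finset ℤ} (hb : b ∈ small2 m₀ c Λ U) :
    b ⊆ S1 c Λ ∪ resonant2 m₀ c Λ U := by
  simp only [small2, extract, Finset.mem_filter, Finset.mem_biUnion] at hb
  obtain ⟨⟨m, -, hm, -⟩, -⟩ := hb
  exact (subset_of_mem_components hm).trans (remaining_subset m)

theorem IsGood.lt_abs_of_mem_S1 {N : ℕ} (hG : IsGood N c Λ) (hε : 0 < c.ε) {i : ℤ}
    (hi : i ∈ S1 c Λ) : (N : ℤ) < |i| := by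
  obtain ⟨him, σ, hσ⟩ := mem_S1.mp hi
  by_contra hN
  have hne : σ ≠ flip σ i := fun h => by
    have := congrFun h ⟨i, him⟩
    simp only [flip, if_true] at this
    exact units_ne_neg_self _ this
  have := hG σ (flip σ i) hne fun j hj => by
    rw [flip_apply_of_ne]
    rintro rfl
    exact hN hj
  linarith

theorem IsGood.lt_abs_of_mem_barbar1 {N : ℕ} (hG : IsGood N c Λ) (hε : 0 < c.ε) {b : Finset ℤ}
    (hb : b ∈ small1 m₀ c Λ) {x : ℤ} (hx : x ∈ barbar1 Λ b) : (N : ℤ) - 2 < |x| := by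
  obtain ⟨-, y, hy, hxy⟩ := mem_collar.mp hx
  obtain ⟨-, z, hz, hyz⟩ := mem_collar.mp hy
  have h1 := hG.lt_abs_of_mem_S1 hε (subset_S1_of_mem_small1 hb hz)
  rw [lt_abs] at h1 ⊢
  rw [abs_le] at hxy hyz
  push_cast at hxy hyz
  omega

theorem IsGood.touched_eq_empty (hG : IsGood 12 c Λ) (hε : 0 < c.ε) {w : Word}
    (hw : ∀ x ∈ w.sites, |x| ≤ 7) : touched m₀ c Λ w = ∅ := by
  refine Finset.filter_false_of_mem fun b hb => ?_
  rw [not_not, Finset.disjoint_left]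
  intro x hx hxb
  have h1 := hG.lt_abs_of_mem_barbar1 hε hb hxb
  have h2 := hw x hx
  push_cast at h1
  omega

/-- The point `y` is too close to the origin to lie in a block, so it is a flip of the graph. The
flips have mutual distance at most `2 * 2 = 4`, and `3 + 4 = 7`. -/
theorem IsGood.abs_le_of_mem_support (hG : IsGood 12 c Λ) (hε : 0 < c.ε) {w : Word}
    (hw : w.multiplicity ≠ 0) (hord : w.order ≤ 2) {y : ℤ} (hy : y ∈ support m₀ c Λ w)
    (hy3 : |y| ≤ 3) : ∀ x ∈ w.sites, |x| ≤ 7 := by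
  rcases Finset.mem_union.mp hy with hy | hy
  · intro x hx
    have := Word.abs_sub_le hw hx hy
    rw [abs_le] at *
    omega
  · obtain ⟨b, hb, hyb⟩ := Finset.mem_biUnion.mp hy
    have := hG.lt_abs_of_mem_barbar1 hε (Finset.mem_filter.mp hb).1 (bar1_subset_barbar1 b hyb)
    push_cast at this
    omega

/-- The flips lie within distance 7 and the twice collared blocks beyond distance 10, so
`energy1_sub` transfers the gap of the energies `E`. -/
theorem IsGood.le_abs_energy1_sub (hG : IsGood 12 c Λ) (hε : 0 < c.ε)
    (hU : IsStep1Rotation m₀ c Λ U) {w : Word} (hw : ∀ x ∈ w.sites, |x| ≤ 7) {σ : Config Λ}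
    (hσ : σ ≠ w.walk σ) :
    4 * c.ε ≤ |energy1 m₀ c Λ U σ - energy1 m₀ c Λ U (w.walk σ)| := by
  have h := energy1_sub hU (l := w.outL ++ w.center :: w.outR) (fun b hb x hx k hk => by
    have h1 := hG.lt_abs_of_mem_barbar1 hε hb hx
    have h2 := hw k (Word.mem_sites.mpr hk)
    rw [lt_abs] at h1 ⊢
    rw [abs_le] at h2
    push_cast at h1
    omega) σ
  rw [Word.walk, h]
  refine hG _ _ hσ fun i hi => (Word.walk_apply_of_notMem fun hm => ?_).symm
  have := hw i hm
  push_cast at hi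
  omega

theorem touchedRotation_of_touched_eq_empty {w : Word} (h : touched m₀ c Λ w = ∅) :
    touchedRotation m₀ c Λ U w = 1 := by
  rw [touchedRotation, h, blockProduct, Finset.toList_empty, List.map_nil, List.prod_nil]

/-- A resonant graph near the origin would touch no block, so its rotated term is the bare one and
its gap is at least `4ε`. This exceeds `ε^|g|`, and bounds the ratio in the second condition by
`(γ/ε)^|g| / 4`. -/
theorem IsGood.lt_abs_of_mem_resonant2 (hG : IsGood 12 c Λ) (hγ : 0 ≤ c.γ) (hε : 0 < c.ε)
    (hε1 : c.ε ≤ 1) (hΓ : ∀ i, |c.Γ i| ≤ 1) (hU : IsStep1Rotation m₀ c Λ U) {y : ℤ}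
    (hy : y ∈ resonant2 m₀ c Λ U) : 3 < |y| := by
  by_contra hy3
  rw [not_lt] at hy3
  simp only [resonant2, Finset.mem_filter] at hy
  obtain ⟨-, w, ⟨α, σ, β, hext, hlen2, hlen3, -, hagree, hne, hres⟩, hyw⟩ := hy
  have hord : w.order ≤ 2 := Nat.le_of_succ_le_succ hlen3
  have hsites := hG.abs_le_of_mem_support hε hext.1.2.2.1 hord hyw hy3
  have htouch : touched m₀ c Λ w = ∅ := hG.touched_eq_empty hε hsites
  have hts : touchedSites m₀ c Λ w = ∅ := by
    rw [touchedSites, htouch, Finset.biUnion_empty]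
  have hα : α = σ := funext fun i => (hagree i (by simp [hts])).1
  have hβ : β = w.walk σ := funext fun i => (hagree i (by simp [hts])).2
  subst hα hβ
  have hgap := hG.le_abs_energy1_sub hε hU hsites hne
  rcases hres with hres | ⟨hres, -⟩
  · have : c.ε ^ w.length ≤ c.ε := pow_le_of_le_one hε.le hε1 (by omega)
    linarith
  · rw [touchedRotation_of_touched_eq_empty htouch, Matrix.one_apply_eq, Matrix.one_apply_eq,
      one_mul, mul_one, abs_div] at hres
    refine absurd hres (not_lt.mpr ?_)
    -- This is where the factor `4` in `IsGood` absorbs the factorial of the second resonance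
    -- condition.
    have hfact : ((w.length - 1).factorial : ℝ) ^ (2 / 9 : ℝ) ≤ 4 := by
      have h2 : ((w.length - 1).factorial : ℝ) ≤ 2 := by
        exact_mod_cast Nat.factorial_le (show w.length - 1 ≤ 2 by omega)
      have h1 : (1 : ℝ) ≤ (w.length - 1).factorial := by
        exact_mod_cast Nat.factorial_pos _
      calc ((w.length - 1).factorial : ℝ) ^ (2 / 9 : ℝ)
          ≤ ((w.length - 1).factorial : ℝ) ^ (1 : ℝ) :=
            Real.rpow_le_rpow_of_exponent_le h1 (by norm_num)
        _ ≤ 4 := by rw [Real.rpow_one]; linarith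
    have hfpos : 0 < ((w.length - 1).factorial : ℝ) ^ (2 / 9 : ℝ) := by positivity
    have hpow : 0 ≤ (c.γ / c.ε) ^ w.length := by positivity
    calc |graphTerm c Λ w α (w.walk α)|
          / |energy1 m₀ c Λ U α - energy1 m₀ c Λ U (w.walk α)|
        ≤ (c.γ * (c.γ / c.ε) ^ w.order) / (4 * c.ε) :=
          div_le_div₀ (by positivity) (isMonomial_graphTerm hγ hε hΓ hext.1 _ _).1
            (by positivity) hgap
      _ = (c.γ / c.ε) ^ w.length / 4 := by
          rw [Word.length, pow_succ]
          field_simp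
      _ ≤ _ := div_le_div_of_nonneg_left hpow hfpos hfact

/-- No twice collared block comes within distance 10 of the origin, so nothing is contracted there.
-/
theorem IsGood.dist1_eq (hG : IsGood 12 c Λ) (hε : 0 < c.ε) {x y : ℤ} (hx : |x| ≤ 10)
    (hy : |y| ≤ 10) : (dist1 m₀ c Λ x y : ℤ) = |x - y| := by
  rw [dist1, Finset.filter_true_of_mem, Int.card_Ico]
  · rw [Int.toNat_of_nonneg (by omega)]
    rcases le_total x y with h | h
    · rw [min_eq_left h, max_eq_right h, abs_of_nonpos (by omega)]
      omega
    · rw [min_eq_right h, max_eq_left h, abs_of_nonneg (by omega)]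
  · rintro k hk b hb ⟨hk1, -⟩
    have h1 := hG.lt_abs_of_mem_barbar1 hε hb hk1
    rw [Finset.mem_Ico, min_le_iff, lt_max_iff] at hk
    rw [lt_abs] at h1
    rw [abs_le] at hx hy
    push_cast at h1
    omega

theorem IsGood.four_le_dist1 (hG : IsGood 12 c Λ) (hε : 0 < c.ε) {y : ℤ} (hy : 3 < |y|) :
    4 ≤ dist1 m₀ c Λ 0 y := by
  have hsub : ∀ z : ℤ, Finset.Ico (min 0 z) (max 0 z) ⊆ Finset.Ico (min 0 y) (max 0 y) →
      dist1 m₀ c Λ 0 z ≤ dist1 m₀ c Λ 0 y := fun z hz =>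
    Finset.card_le_card (Finset.filter_subset_filter _ hz)
  rcases lt_abs.mp hy with h | h
  · have h4 : (dist1 m₀ c Λ 0 4 : ℤ) = |0 - 4| := hG.dist1_eq hε (by norm_num) (by norm_num)
    have := hsub 4 (Finset.Ico_subset_Ico (by omega) (by omega))
    norm_num at h4
    omega
  · have h4 : (dist1 m₀ c Λ 0 (-4) : ℤ) = |0 - -4| := hG.dist1_eq hε (by norm_num) (by norm_num)
    have := hsub (-4) (Finset.Ico_subset_Ico (by omega) (by omega))
    norm_num at h4
    omega

/-- All points of a step 2 block are at least four steps away from the origin, and the collar has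
only three. -/
theorem IsGood.zero_notMem_bar2 (hG : IsGood 12 c Λ) (hγ : 0 ≤ c.γ) (hε : 0 < c.ε)
    (hε1 : c.ε ≤ 1) (hΓ : ∀ i, |c.Γ i| ≤ 1) (hU : IsStep1Rotation m₀ c Λ U) {b : Finset ℤ}
    (hb : b ∈ small2 m₀ c Λ U) : (0 : ℤ) ∉ bar2 m₀ c Λ b := by
  intro h0
  simp only [bar2, collar1, Finset.mem_filter] at h0
  obtain ⟨-, y, hy, hd⟩ := h0
  have hy3 : 3 < |y| := by
    rcases Finset.mem_union.mp (subset_of_mem_small2 hb hy) with h | h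
    · have := hG.lt_abs_of_mem_S1 hε h
      push_cast at this
      omega
    · exact hG.lt_abs_of_mem_resonant2 hγ hε hε1 hΓ hU h
  have := hG.four_le_dist1 (m₀ := m₀) hε hy3
  omega

end NearOrigin

/-! ### The generators: antisymmetry and commutators with `S^z_0` -/

section Generators

variable {Λ : Box} {m₀ : ℕ} {c : Couplings} {U : Finset ℤ → Op Λ}

theorem touched_reverse (w : Word) : touched m₀ c Λ w.reverse = touched m₀ c Λ w := by
  simp only [touched, Word.sites_reverse]

theorem support_reverse (w : Word) : support m₀ c Λ w.reverse = support m₀ c Λ w := by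
  rw [support, support, touchedSites, touchedSites, touched_reverse, Word.sites_reverse]

theorem isPerturbative_reverse {w : Word} :
    IsPerturbative m₀ c Λ U w.reverse ↔ IsPerturbative m₀ c Λ U w := by
  rw [IsPerturbative, isExternal_reverse, Word.length_reverse, support_reverse, IsPerturbative]

theorem transpose_rotatedTerm (w : Word) :
    (rotatedTerm m₀ c Λ U w)ᵀ = rotatedTerm m₀ c Λ U w.reverse := by
  have h : touchedRotation m₀ c Λ U w.reverse = touchedRotation m₀ c Λ U w := by
    rw [touchedRotation, touched_reverse, touchedRotation]
  rw [rotatedTerm, rotatedTerm, h, Matrix.transpose_mul, Matrix.transpose_mul,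
    Matrix.transpose_transpose, transpose_graphTerm, Matrix.mul_assoc]

theorem transpose_A2term (w : Word) :
    (A2term m₀ c Λ U w)ᵀ = -A2term m₀ c Λ U w.reverse := by
  ext α β
  rw [Matrix.transpose_apply, Matrix.neg_apply, A2term, A2term]
  by_cases h : α = β
  · rw [if_pos h, if_pos h.symm, neg_zero]
  · rw [if_neg h, if_neg (Ne.symm h), ← transpose_rotatedTerm, Matrix.transpose_apply,
      ← neg_sub, div_neg]

theorem transpose_A1_sum (X : Finset ℤ) : (∑ i ∈ X, A1 c Λ i)ᵀ = -∑ i ∈ X, A1 c Λ i := by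
  rw [Matrix.transpose_sum, ← Finset.sum_neg_distrib]
  exact Finset.sum_congr rfl fun i _ => transpose_A1 c i

/-- Reversal is an involution of the perturbative graphs, and transposing a term gives minus the
term of the reversed graph, as the energy denominator changes sign. -/
theorem transpose_A2 : (A2 m₀ c Λ U)ᵀ = -A2 m₀ c Λ U := by
  let e : Word ≃ Word := ⟨Word.reverse, Word.reverse, Word.reverse_reverse, Word.reverse_reverse⟩
  rw [A2, Matrix.transpose_tsum, ← tsum_neg, ← e.tsum_eq]
  refine tsum_congr fun w => ?_
  have he : e w = w.reverse := rfl
  rw [he]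
  by_cases hw : IsPerturbative m₀ c Λ U w
  · rw [if_pos (isPerturbative_reverse.mpr hw), if_pos hw, transpose_A2term,
      Word.reverse_reverse]
  · rw [if_neg (isPerturbative_reverse.not.mpr hw), if_neg hw, Matrix.transpose_zero, neg_zero]

theorem norm_Sz_le (i : ℤ) : ‖Sz Λ i‖ ≤ 1 := by
  rw [Sz, Matrix.l2_opNorm_diagonal]
  refine (pi_norm_le_iff_of_nonneg zero_le_one).mpr fun σ => ?_
  rcases spin_eq_one_or σ i with h | h <;> simp [h]

theorem actsOn_A1 (i : ℤ) : ActsOn {i} (A1 c Λ i) := by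
  intro σ τ hne j hj
  rw [A1, ne_eq, ite_eq_right_iff, Classical.not_imp] at hne
  rw [hne.1, flip_apply_of_ne _ (by simpa using hj)]

/-- Only `A(0)` can fail to commute with `S^z_0`, which makes the bound independent of the box. -/
theorem norm_commutator_A1_sum_le (hγ : 0 ≤ c.γ) (hε : 0 < c.ε) (hΓ : ∀ i, |c.Γ i| ≤ 1) :
    ‖(∑ i ∈ Λ.sites \ S1 c Λ, A1 c Λ i) * Sz Λ 0 - Sz Λ 0 * ∑ i ∈ Λ.sites \ S1 c Λ, A1 c Λ i‖
      ≤ 2 * (c.γ / c.ε) := by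
  have hnn : 0 ≤ 2 * (c.γ / c.ε) := by positivity
  rw [Finset.sum_mul, Finset.mul_sum, ← Finset.sum_sub_distrib]
  by_cases h0 : (0 : ℤ) ∈ Λ.sites \ S1 c Λ
  · rw [Finset.sum_eq_single_of_mem 0 h0 fun i _ hi => sub_eq_zero.mpr
      ((actsOn_A1 i).commute_Sz (by simpa using hi.symm))]
    refine (norm_commutator_le (norm_Sz_le 0)).trans (mul_le_mul_of_nonneg_left ?_ zero_le_two)
    rw [Finset.mem_sdiff] at h0
    exact (isMonomial_A1 hγ hε hΓ h0.1 h0.2).norm_le (foldl_flip_involutive [0]).injective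
      (by positivity)
  · rw [Finset.sum_eq_zero fun i hi => sub_eq_zero.mpr ((actsOn_A1 i).commute_Sz ?_), norm_zero]
    · exact hnn
    · rw [Finset.mem_singleton]
      rintro rfl
      exact h0 hi

theorem actsOn_graphTerm (hγ : 0 ≤ c.γ) (hε : 0 < c.ε) (hΓ : ∀ i, |c.Γ i| ≤ 1) {w : Word}
    (hw : IsGraph c Λ w) : ActsOn w.sites (graphTerm c Λ w) := by
  intro σ τ hne i hi
  rw [(isMonomial_graphTerm hγ hε hΓ hw σ τ).2 hne, Word.walk_apply_of_notMem hi]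

theorem actsOn_A2term (hγ : 0 ≤ c.γ) (hε : 0 < c.ε) (hΓ : ∀ i, |c.Γ i| ≤ 1)
    (hU : IsStep1Rotation m₀ c Λ U) {w : Word} (hw : IsGraph c Λ w) :
    ActsOn (support m₀ c Λ w) (A2term m₀ c Λ U w) := by
  have hO : ActsOn (support m₀ c Λ w) (touchedRotation m₀ c Λ U w) :=
    (hU.blockProduct_actsOn (Finset.filter_subset _ _)).mono Finset.subset_union_right
  have hR : ActsOn (support m₀ c Λ w) (rotatedTerm m₀ c Λ U w) :=
    (hO.transpose.mul ((actsOn_graphTerm hγ hε hΓ hw).mono Finset.subset_union_left)).mul hO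
  intro α β hne
  refine hR α β fun h => hne ?_
  rw [A2term, h, zero_div, ite_self]

/-- Near the origin the rotation of a graph is trivial, so the term is monomial with an energy
denominator at least `4ε`. -/
theorem IsGood.norm_A2term_le (hG : IsGood 12 c Λ) (hγ : 0 ≤ c.γ) (hε : 0 < c.ε)
    (hγε : c.γ ≤ c.ε) (hΓ : ∀ i, |c.Γ i| ≤ 1) (hU : IsStep1Rotation m₀ c Λ U) {w : Word}
    (hw : IsGraph c Λ w) (hsites : ∀ x ∈ w.sites, |x| ≤ 7) :
    ‖A2term m₀ c Λ U w‖ ≤ c.γ / c.ε := by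
  have hle1 : c.γ / c.ε ≤ 1 := (div_le_one hε).mpr hγε
  have hnn : 0 ≤ c.γ / c.ε := by positivity
  have hinj : Function.Injective (w.walk (Λ := Λ)) :=
    (foldl_flip_involutive (w.outL ++ w.center :: w.outR)).injective
  have hrot : rotatedTerm m₀ c Λ U w = graphTerm c Λ w := by
    rw [rotatedTerm, touchedRotation_of_touched_eq_empty (hG.touched_eq_empty hε hsites),
      Matrix.transpose_one, Matrix.one_mul, Matrix.mul_one]
  refine IsMonomial.norm_le hinj hnn fun α β => ?_
  rw [A2term, hrot]
  obtain ⟨hb, hm⟩ := isMonomial_graphTerm hγ hε hΓ hw α β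
  by_cases h : graphTerm c Λ w α β = 0
  · simp [h, hnn]
  · obtain rfl := hm h
    refine ⟨?_, fun _ => rfl⟩
    split_ifs with hαβ
    · simpa using hnn
    · rw [abs_div]
      calc _ ≤ (c.γ * (c.γ / c.ε) ^ w.order) / (4 * c.ε) :=
            div_le_div₀ (by positivity) hb (by positivity)
              (hG.le_abs_energy1_sub hε hU hsites hαβ)
        _ ≤ c.γ * 1 / c.ε := by
            gcongr
            · exact pow_le_one₀ hnn hle1
            · linarith
        _ = c.γ / c.ε := by rw [mul_one]

theorem IsPerturbative.order_le {w : Word} (hw : IsPerturbative m₀ c Λ U w) : w.order ≤ 2 :=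
  Nat.le_of_succ_le_succ hw.2.2.1

open Classical in
theorem A2_eq_sum : A2 m₀ c Λ U = ∑ w ∈ shortWords Λ.sites,
    if IsPerturbative m₀ c Λ U w then A2term m₀ c Λ U w else 0 := by
  refine tsum_eq_sum fun w hw => if_neg fun hp => hw ?_
  exact mem_shortWords hp.order_le hp.1.1.1

/-- Graphs whose support misses the origin commute with `S^z_0`. The others are words of order at
most two in `[-7, 7]`, and their number does not depend on the box. -/
theorem IsGood.norm_commutator_A2_le (hG : IsGood 12 c Λ) (hγ : 0 ≤ c.γ) (hε : 0 < c.ε)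
    (hγε : c.γ ≤ c.ε) (hΓ : ∀ i, |c.Γ i| ≤ 1) (hU : IsStep1Rotation m₀ c Λ U) :
    ‖A2 m₀ c Λ U * Sz Λ 0 - Sz Λ 0 * A2 m₀ c Λ U‖
      ≤ (shortWords (Finset.Icc (-7) 7)).card * (2 * (c.γ / c.ε)) := by
  classical
  generalize hX : Finset.Icc (-7 : ℤ) 7 = X
  have hnn : 0 ≤ 2 * (c.γ / c.ε) := by positivity
  set f : Word → Op Λ := fun w =>
    if IsPerturbative m₀ c Λ U w then A2term m₀ c Λ U w else 0 with hf
  have hzero : ∀ w, w ∉ shortWords X → f w * Sz Λ 0 - Sz Λ 0 * f w = 0 := by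
    intro w hw
    simp only [hf]
    split_ifs with hp
    · refine sub_eq_zero.mpr ((actsOn_A2term hγ hε hΓ hU hp.1.1).commute_Sz fun h0 => hw ?_)
      have := hG.abs_le_of_mem_support hε hp.1.1.2.2.1 hp.order_le h0 (by norm_num)
      exact mem_shortWords hp.order_le fun x hx =>
        hX ▸ Finset.mem_Icc.mpr (abs_le.mp (this x hx))
    · simp
  have hle : ∀ w, ‖f w * Sz Λ 0 - Sz Λ 0 * f w‖ ≤ 2 * (c.γ / c.ε) := by
    intro w
    by_cases hw : IsPerturbative m₀ c Λ U w ∧ (0 : ℤ) ∈ support m₀ c Λ w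
    · simp only [hf, if_pos hw.1]
      refine (norm_commutator_le (norm_Sz_le 0)).trans (mul_le_mul_of_nonneg_left ?_ zero_le_two)
      exact hG.norm_A2term_le hγ hε hγε hΓ hU hw.1.1.1
        (hG.abs_le_of_mem_support hε hw.1.1.1.2.2.1 hw.1.order_le hw.2 (by norm_num))
    · have : f w * Sz Λ 0 - Sz Λ 0 * f w = 0 := by
        simp only [hf]
        split_ifs with hp
        · exact sub_eq_zero.mpr ((actsOn_A2term hγ hε hΓ hU hp.1.1).commute_Sz
            fun h0 => hw ⟨hp, h0⟩)
        · simp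
      rw [this, norm_zero]
      exact hnn
  rw [A2_eq_sum, Finset.sum_mul, Finset.mul_sum, ← Finset.sum_sub_distrib]
  change ‖∑ w ∈ shortWords Λ.sites, (f w * Sz Λ 0 - Sz Λ 0 * f w)‖ ≤ _
  rw [← Finset.sum_filter_of_ne (p := fun w => w ∈ shortWords X)
    fun w _ hne => by_contra fun hw => hne (hzero w hw)]
  refine (norm_sum_le_of_le _ fun w _ => hle w).trans ?_
  rw [Finset.sum_const, nsmul_eq_mul]
  refine mul_le_mul_of_nonneg_right ?_ hnn
  exact_mod_cast Finset.card_le_card fun w hw => (Finset.mem_filter.mp hw).2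

end Generators

end SpinChain
end

noncomputable section

namespace SpinChain

open scoped Matrix.Norms.L2Operator

/-! ### The cumulative rotation and the average of `S^z_0` -/

section CumulativeRotation

variable {Λ : Box} {m₀ : ℕ} {c : Couplings} {U U' : Finset ℤ → Op Λ}

theorem Omega1_orthogonal : (Omega1 c Λ)ᵀ * Omega1 c Λ = 1 :=
  exp_orthogonal (by rw [Matrix.transpose_neg, transpose_A1_sum])

theorem Omega2_orthogonal : (Omega2 m₀ c Λ U)ᵀ * Omega2 m₀ c Λ U = 1 :=
  exp_orthogonal (by rw [Matrix.transpose_neg, transpose_A2])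

theorem IsStep1Rotation.O1_orthogonal (hU : IsStep1Rotation m₀ c Λ U) :
    (O1 m₀ c Λ U)ᵀ * O1 m₀ c Λ U = 1 :=
  hU.blockProduct_orthogonal subset_rfl

theorem IsStep2Rotation.O2_orthogonal (hU' : IsStep2Rotation m₀ c Λ U U') :
    (O2 m₀ c Λ U U')ᵀ * O2 m₀ c Λ U U' = 1 :=
  blockProduct_induction (fun M => Mᵀ * M = 1) (by simp) (fun _ _ => transpose_mul_mul)
    fun b hb => (hU' b hb).orthogonal

theorem R2_orthogonal (hU : IsStep1Rotation m₀ c Λ U) (hU' : IsStep2Rotation m₀ c Λ U U') :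
    (R2 m₀ c Λ U U')ᵀ * R2 m₀ c Λ U U' = 1 :=
  transpose_mul_mul (transpose_mul_mul (transpose_mul_mul Omega1_orthogonal hU.O1_orthogonal)
    Omega2_orthogonal) hU'.O2_orthogonal

/-- Telescoping: conjugation with the orthogonal `W` preserves the norm of the displacement due to
`V`, so displacements add up along a product of rotations. -/
theorem norm_conj_mul_sub_le {V W S : Op Λ} (hW : Wᵀ * W = 1) :
    ‖(V * W)ᵀ * S * (V * W) - S‖ ≤ ‖Vᵀ * S * V - S‖ + ‖Wᵀ * S * W - S‖ := by
  have h : (V * W)ᵀ * S * (V * W) - S = Wᵀ * (Vᵀ * S * V - S) * W + (Wᵀ * S * W - S) := by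
    rw [Matrix.transpose_mul]
    noncomm_ring
  rw [h, ← norm_conj_of_orthogonal hW (Vᵀ * S * V - S)]
  exact norm_add_le _ _

theorem conj_Sz_of_actsOn {X : Finset ℤ} {M : Op Λ} (hM : Mᵀ * M = 1) (hX : ActsOn X M) {i : ℤ}
    (hi : i ∉ X) : Mᵀ * Sz Λ i * M - Sz Λ i = 0 := by
  rw [Matrix.mul_assoc, ← hX.commute_Sz hi, ← Matrix.mul_assoc, hM, Matrix.one_mul, sub_self]

theorem IsGood.norm_conj_R2_sub_le (hG : IsGood 12 c Λ) (hγ : 0 ≤ c.γ) (hε : 0 < c.ε)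
    (hε1 : c.ε ≤ 1) (hγε : c.γ ≤ c.ε) (hΓ : ∀ i, |c.Γ i| ≤ 1) (hU : IsStep1Rotation m₀ c Λ U)
    (hU' : IsStep2Rotation m₀ c Λ U U') :
    ‖(R2 m₀ c Λ U U')ᵀ * Sz Λ 0 * R2 m₀ c Λ U U' - Sz Λ 0‖
      ≤ (2 + 2 * (shortWords (Finset.Icc (-7) 7)).card) * (c.γ / c.ε) := by
  have h1 : ‖(Omega1 c Λ)ᵀ * Sz Λ 0 * Omega1 c Λ - Sz Λ 0‖ ≤ 2 * (c.γ / c.ε) :=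
    (norm_exp_conj_sub_le (transpose_A1_sum _) _).trans (norm_commutator_A1_sum_le hγ hε hΓ)
  have h2 : (O1 m₀ c Λ U)ᵀ * Sz Λ 0 * O1 m₀ c Λ U - Sz Λ 0 = 0 := by
    refine conj_Sz_of_actsOn hU.O1_orthogonal (hU.blockProduct_actsOn subset_rfl) fun h0 => ?_
    obtain ⟨b, hb, h0b⟩ := Finset.mem_biUnion.mp h0
    have := hG.lt_abs_of_mem_barbar1 hε hb (bar1_subset_barbar1 b h0b)
    norm_num at this
  have h3 : ‖(Omega2 m₀ c Λ U)ᵀ * Sz Λ 0 * Omega2 m₀ c Λ U - Sz Λ 0‖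
      ≤ (shortWords (Finset.Icc (-7) 7)).card * (2 * (c.γ / c.ε)) :=
    (norm_exp_conj_sub_le transpose_A2 _).trans
      (hG.norm_commutator_A2_le hγ hε hγε hΓ hU)
  have h4 : (O2 m₀ c Λ U U')ᵀ * Sz Λ 0 * O2 m₀ c Λ U U' - Sz Λ 0 = 0 := by
    have ha : ActsOn ((small2 m₀ c Λ U).biUnion (bar2 m₀ c Λ)) (O2 m₀ c Λ U U') :=
      blockProduct_induction (ActsOn _) (actsOn_one _) (fun _ _ => ActsOn.mul)
        fun b hb => ActsOn.mono (hU' b hb).acts (Finset.subset_biUnion_of_mem _ hb)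
    refine conj_Sz_of_actsOn hU'.O2_orthogonal ha fun h0 => ?_
    obtain ⟨b, hb, h0b⟩ := Finset.mem_biUnion.mp h0
    exact hG.zero_notMem_bar2 hγ hε hε1 hΓ hU hb h0b
  rw [R2]
  refine (norm_conj_mul_sub_le hU'.O2_orthogonal).trans ?_
  rw [h4, norm_zero, add_zero]
  refine (norm_conj_mul_sub_le Omega2_orthogonal).trans ?_
  have h12 := norm_conj_mul_sub_le (V := Omega1 c Λ) (S := Sz Λ 0) hU.O1_orthogonal
  rw [h2, norm_zero, add_zero] at h12
  linarith

theorem exists_norm_conj_R2_sub_le : ∃ A : ℝ, 0 ≤ A ∧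
    ∀ (Λ : Box) (m₀ : ℕ) (c : Couplings) (U U' : Finset ℤ → Op Λ), IsGood 12 c Λ → 0 ≤ c.γ →
      0 < c.ε → c.ε ≤ 1 → c.γ ≤ c.ε → (∀ i, |c.Γ i| ≤ 1) → IsStep1Rotation m₀ c Λ U →
      IsStep2Rotation m₀ c Λ U U' →
      ‖(R2 m₀ c Λ U U')ᵀ * Sz Λ 0 * R2 m₀ c Λ U U' - Sz Λ 0‖ ≤ A * (c.γ / c.ε) :=
  ⟨_, add_nonneg zero_le_two (mul_nonneg zero_le_two (Nat.cast_nonneg _)),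
    fun _ _ _ _ _ hG hγ hε hε1 hγε hΓ hU hU' =>
      hG.norm_conj_R2_sub_le hγ hε hε1 hγε hΓ hU hU'⟩

theorem averageSz_nonneg {p : Config Λ → ℝ} (hp : ∀ α, 0 ≤ p α) (R : Op Λ) :
    0 ≤ averageSz p R :=
  Finset.sum_nonneg fun α _ => mul_nonneg (hp α) (abs_nonneg _)

theorem averageSz_le_one {p : Config Λ → ℝ} (hp : ∀ α, 0 ≤ p α) (hp1 : ∑ α, p α = 1)
    {R : Op Λ} (hR : Rᵀ * R = 1) : averageSz p R ≤ 1 := by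
  rw [averageSz, ← hp1]
  refine Finset.sum_le_sum fun α _ => mul_le_of_le_one_right (hp α) ?_
  exact (abs_entry_le_norm _ _ _).trans
    ((norm_conj_of_orthogonal hR _).trans_le (norm_Sz_le 0))

/-- The diagonal entries of `S^z_0` are `±1`, so the bound holds for each `α` separately; this is
why arbitrary disorder-dependent weights are allowed. -/
theorem le_averageSz {p : Config Λ → ℝ} (hp : ∀ α, 0 ≤ p α) (hp1 : ∑ α, p α = 1)
    {R : Op Λ} {δ : ℝ} (hR : ‖Rᵀ * Sz Λ 0 * R - Sz Λ 0‖ ≤ δ) : 1 - δ ≤ averageSz p R := by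
  rw [averageSz, ← one_mul (1 - δ), ← hp1, Finset.sum_mul]
  refine Finset.sum_le_sum fun α _ => mul_le_mul_of_nonneg_left ?_ (hp α)
  have h1 := (abs_entry_le_norm _ α α).trans hR
  have h2 : |Sz Λ 0 α α| = 1 := by
    rw [Sz, Matrix.diagonal_apply_eq]
    rcases spin_eq_one_or α 0 with h | h <;> simp [h]
  rw [Matrix.sub_apply] at h1
  have h3 := abs_sub_abs_le_abs_sub (Sz Λ 0 α α) ((Rᵀ * Sz Λ 0 * R) α α)
  rw [abs_sub_comm] at h1
  linarith

theorem aemeasurable_averageSz {Ω : Type*} [MeasurableSpace Ω] {μ : Measure Ω}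
    {p : Ω → Config Λ → ℝ} {R : Ω → Op Λ} (hR : ∀ σ α, AEMeasurable (fun ω => R ω σ α) μ)
    (hp : ∀ α, AEMeasurable (fun ω => p ω α) μ) :
    AEMeasurable (fun ω => averageSz (p ω) (R ω)) μ := by
  refine Finset.aemeasurable_fun_sum _ fun α _ => (hp α).mul ?_
  have h : ∀ ω, ((R ω)ᵀ * Sz Λ 0 * R ω) α α = ∑ σ, R ω σ α * spin σ 0 * R ω σ α := fun ω => by
    rw [Matrix.mul_apply]
    exact Finset.sum_congr rfl fun σ _ => by
      rw [Sz, Matrix.mul_diagonal, Matrix.transpose_apply]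
  simp only [h]
  exact (continuous_abs.measurable.comp_aemeasurable
    (Finset.aemeasurable_fun_sum _ fun σ _ => ((hR σ α).mul_const _).mul (hR σ α)))

end CumulativeRotation

end SpinChain

end

/-! ### Expectation over the disorder -/

theorem proposition3p2 (ρ₀ ν C : ℝ) (hν : 0 < ν) (m₀ : ℕ) (hm₀ : 0 < m₀) :
    ∃ K γ₀ : ℝ, 0 < γ₀ ∧
      ∀ (Ω : Type*) [MeasurableSpace Ω] (μ : Measure Ω) [IsProbabilityMeasure μ]
        (V : SpinChain.RandomCouplings Ω) (γ : ℝ),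
        SpinChain.IsDisorder μ ρ₀ V → 0 < γ → γ < γ₀ → SpinChain.LLA μ V γ ν C →
        ∀ (Λ : SpinChain.Box) (U U' : Ω → Finset ℤ → SpinChain.Op Λ)
          (p : Ω → SpinChain.Config Λ → ℝ),
          (∀ᵐ ω ∂μ, SpinChain.IsStep1Rotation m₀ (V.at γ ω) Λ (U ω)) →
          (∀ᵐ ω ∂μ, SpinChain.IsStep2Rotation m₀ (V.at γ ω) Λ (U ω) (U' ω)) →
          (∀ σ α, AEMeasurable
            (fun ω => SpinChain.R2 m₀ (V.at γ ω) Λ (U ω) (U' ω) σ α) μ) →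
          (∀ α, AEMeasurable (fun ω => p ω α) μ) →
          (∀ᵐ ω ∂μ, (∀ α, 0 ≤ p ω α) ∧ ∑ α, p ω α = 1) →
          Integrable (fun ω => SpinChain.averageSz (p ω)
            (SpinChain.R2 m₀ (V.at γ ω) Λ (U ω) (U' ω))) μ ∧
          |∫ ω, SpinChain.averageSz (p ω)
            (SpinChain.R2 m₀ (V.at γ ω) Λ (U ω) (U' ω)) ∂μ - 1| ≤ K * γ ^ (1 / 20 : ℝ) := by
  obtain ⟨A, hA0, hA⟩ := SpinChain.exists_norm_conj_R2_sub_le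
  obtain ⟨B, hB0, hB⟩ := SpinChain.exists_measurableSet_not_isGood ρ₀ 12
  -- `A` bounds the displacement for good disorder, `B` the probability of `D`. The bound `γ < 1` is
  -- only needed to have `ε ≤ 1`.
  refine ⟨A + B, 1, one_pos, ?_⟩
  intro Ω _ μ _ V γ hV hγ hγ1 _ Λ U U' p hU hU' hR hp hp1
  obtain ⟨ε, hεdef⟩ : ∃ ε : ℝ, ε = γ ^ (1 / 20 : ℝ) := ⟨_, rfl⟩
  have hε : 0 < ε := hεdef ▸ Real.rpow_pos_of_pos hγ _
  have hε1 : ε ≤ 1 := hεdef ▸ Real.rpow_le_one hγ.le hγ1.le (by norm_num)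
  have hγpow : γ = ε ^ 20 := by
    rw [hεdef, ← Real.rpow_natCast, ← Real.rpow_mul hγ.le]
    norm_num
  have hγε : γ / ε ≤ ε := by
    rw [div_le_iff₀ hε, hγpow, ← sq]
    exact pow_le_pow_of_le_one hε.le hε1 (by norm_num)
  have hγε' : γ ≤ ε := by
    rw [hγpow]
    exact pow_le_of_le_one hε.le hε1 (by norm_num)
  have hΓ : ∀ᵐ ω ∂μ, ∀ i, |V.Γ i ω| ≤ 1 := ae_all_iff.mpr fun i => hV.bounded (1, i)
  obtain ⟨D, hDm, hDgood, hDμ⟩ := hB Ω μ V γ Λ hV hγ.le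
  rw [← hεdef] at hDμ
  have hDreal : μ.real D ≤ B * ε := ENNReal.toReal_le_of_le_ofReal (by positivity) hDμ
  set X : Ω → ℝ := fun ω => SpinChain.averageSz (p ω)
    (SpinChain.R2 m₀ (V.at γ ω) Λ (U ω) (U' ω)) with hX
  have hX0 : ∀ᵐ ω ∂μ, 0 ≤ X ω := by
    filter_upwards [hp1] with ω h
    exact SpinChain.averageSz_nonneg h.1 _
  have hX1 : ∀ᵐ ω ∂μ, X ω ≤ 1 := by
    filter_upwards [hp1, hU, hU'] with ω h h1 h2
    exact SpinChain.averageSz_le_one h.1 h.2 (SpinChain.R2_orthogonal h1 h2)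
  have hXint : Integrable X μ := by
    refine Integrable.of_bound (SpinChain.aemeasurable_averageSz hR hp).aestronglyMeasurable 1 ?_
    filter_upwards [hX0, hX1] with ω h0 h1
    rwa [Real.norm_eq_abs, abs_of_nonneg h0]
  -- On `D` the left side is `-A * ε ≤ 0`, so that nonnegativity of the average suffices there.
  have hlower : ∀ᵐ ω ∂μ, (1 - A * ε) - D.indicator (fun _ => (1 : ℝ)) ω ≤ X ω := by
    filter_upwards [hp1, hU, hU', hΓ, hX0] with ω h h1 h2 h3 h0
    by_cases hω : ω ∈ D
    · rw [Set.indicator_of_mem hω]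
      have : 0 ≤ A * ε := by positivity
      linarith
    · rw [Set.indicator_of_notMem hω, sub_zero]
      have hc : (V.at γ ω).ε = ε := hεdef.symm
      refine SpinChain.le_averageSz h.1 h.2 ((hA Λ m₀ _ _ _ (hDgood ω hω) hγ.le ?_ ?_ ?_
        h3 h1 h2).trans ?_)
      · rwa [hc]
      · rwa [hc]
      · rwa [hc]
      · rw [hc]
        exact mul_le_mul_of_nonneg_left hγε hA0
  have hupper : ∫ ω, X ω ∂μ ≤ 1 := by
    have := integral_mono_ae hXint (integrable_const (1 : ℝ)) hX1
    simpa using this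
  have hind : Integrable (D.indicator fun _ => (1 : ℝ)) μ :=
    (integrable_const (1 : ℝ)).indicator hDm
  have hlow : 1 - A * ε - μ.real D ≤ ∫ ω, X ω ∂μ := by
    have := integral_mono_ae ((integrable_const (1 - A * ε)).sub hind) hXint hlower
    rwa [integral_sub' (integrable_const _) hind, integral_const, probReal_univ, one_smul,
      integral_indicator_const _ hDm, smul_eq_mul, mul_one] at this
  refine ⟨hXint, ?_⟩
  rw [← hεdef, abs_le]
  constructor <;> nlinarith
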